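/- Setting. Let $A=\bigoplus_{k\in\mathbb Z}A^{(k)}$ be a unital complex $*$-algebra that is a comodule algebra over the Hopf algebra $\mathbb C[z,z^{-1}]$ of polynomial functions on $U(1)$ (coaction $a\mapsto a\otimes z^k$ on $A^{(k)}$, $(A^{(k)})^*=A^{(-k)}$), put $\mathcal B=A^{(0)}$ and let $\delta(a)=ka$ for $a\in A^{(k)}$. Assume that $\mathcal B\hookrightarrow A$ is a Hopf–Galois extension, i.e. the canonical map $A\otimes_{\mathcal B}A\to A\otimes\mathbb C[z,z^{-1}]$, $a'\otimes a\mapsto a'a_{(0)}\otimes a_{(1)}$, is bijective. Let $(A,D,\mathcal H)$ be a spectral triple: $A$ is represented by bounded operators on the Hilbert space $\mathcal H$, $D$ is selfadjoint with compact resolvent, and every $a\in A$ preserves $\operatorname{dom}D$ and has bounded commutator with $D$. Let $J$ be antiunitary with $J^2=-1$, $JD=DJ$, $[a,Jb^*J^{-1}]=0$ and $[[D,a],Jb^*J^{-1}]=0$ for $a,b\in A$. Let the triple be $U(1)$-equivariant: there is a selfadjoint operator $\delta$ on $\mathcal H$ generating a unitary $U(1)$-action, so that $\mathcal H$ is the closed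 direct sum of the eigenspaces $\mathcal H_k=\ker(\delta-k)$, $k\in\mathbb Z$, with $[\delta,a]=\delta(a)$ for $a\in A$, $J\delta=-\delta J$, and $D\delta=\delta D$ (i.e. $D$ commutes with the $U(1)$-action). Call an operator $D'$ *projectable* by $\Gamma$ if $\Gamma=\Gamma^*$ is bounded, $\Gamma^2=1$, $\Gamma$ commutes with $A$ and with $\delta$, $\Gamma J=-J\Gamma$, and $\Gamma$ preserves $\operatorname{dom}D'$; its horizontal part is then $D'_h=\tfrac12\Gamma[\Gamma,D']$. Say that $D'$ has *fibres of equal length* (with $\ell=1$) if $D'-D'_h-\Gamma\delta$ is densely defined and extends to a bounded operator $Z'$ commuting with $Ja^*J^{-1}$ for all $a\in A$. Assume that $D$ is projectable by $\Gamma$ and has fibres of equal length, with remainder $Z$, and that $[D_h,b]=[D,b]$ for all $b\in\mathcal B$. Let $\Omega^1_D(A)=\{\sum_ip_i[D,q_i]:p_i,q_i\in A\}$, and similarly $\Omega^1_D(\mathcal B)$, and assume that $\sum_i p_i[D,q_i]=0$ implies $\sum_ip_i\delta(q_i)=0$. Let $\omega=\omega^*\in\Omega^1_D(A)$ be a selfadjoint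 strong connection: $[\delta,\omega]=0$; $\sum_ip_i\delta(q_i)=1$ whenever $\omega=\sum_ip_i[D,q_i]$; and $[D,a]-\delta(a)\omega\in\Omega^1_D(\mathcal B)A$ for all $a\in A$. (Identities between elements of $A$ are understood for the operators representing them.) Let $ha=Ja^*J^{-1}h$ and $h\eta=-J\eta^*J^{-1}h$ be the right actions on $\mathcal H$ of $a\in A$ and of one-forms $\eta$, and let $D_0$ be the restriction of $D_h$ to $\mathcal H_0$. Let $D_\omega^{(k)}$ be the closure of $$hp\longmapsto (D_0h)p+h\,([D,p]-k\,p\,\omega),\qquad h\in\mathcal H_0\cap\operatorname{dom}D,\ p\in A^{(k)},$$ extended linearly, and let $D_\omega$ be the closure of the direct sum of the $D_\omega^{(k)}$, $k\in\mathbb Z$. Put $\mathcal D_\omega=\Gamma\delta+D_\omega$ on $\operatorname{dom}\delta\cap\operatorname{dom}D_\omega$. Proposition. Suppose that $Z$ commutes with $A$. Then $D_\omega$ is well defined and $(A,\mathcal D_\omega,\mathcal H)$ is a spectral triple; in particular $\mathcal D_\omega$ is selfadjoint with compact resolvent. It commutes with the $U(1)$-action, it is projectable by the same $\Gamma$, and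 it has fibres of equal length ($\ell=1$). The horizontal part $\tfrac12\Gamma[\Gamma,\mathcal D_\omega]$, defined on $\operatorname{dom}\mathcal D_\omega$, coincides there with $D_\omega$, and its closure is $D_\omega$. Moreover $\mathcal D_\omega^2=D_\omega^2+\delta^2$ as unbounded operators (including equality of domains). -/

import Mathlib

open scoped TensorProduct ComplexConjugate LaurentPolynomial

noncomputable section

namespace CircleBundle

/-! ### The algebraic `U(1)` bundle

The Hopf algebra of (polynomial) functions on `U(1)` is `ℂ[T;T⁻¹]`; a right coaction of it on an
algebra `A` is the same thing as a `ℤ`-grading `𝒜` of `A`, where `a ∈ 𝒜 k` iff `Δ_R a = a ⊗ T ^ k`.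
The subalgebra of coinvariants is `ℬ = 𝒜 0`. -/

section Bundle

variable {A : Type*} [Ring A] [Algebra ℂ A] (𝒜 : ℤ → Submodule ℂ A) [GradedAlgebra 𝒜]

/-- The derivation `δ` of `A` generating the `U(1)` action: `δ a = k a` for `a ∈ 𝒜 k`. -/
def circleDeriv : A →ₗ[ℂ] A :=
  (DirectSum.toModule ℂ ℤ A fun k : ℤ => (k : ℂ) • (𝒜 k).subtype) ∘ₗ
    (DirectSum.decomposeLinearEquiv 𝒜).toLinearMap

/-- The right coaction `Δ_R : A → A ⊗ ℂ[T;T⁻¹]`, `Δ_R a = a ⊗ T ^ k` for `a ∈ 𝒜 k`. -/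
def coaction : A →ₗ[ℂ] A ⊗[ℂ] ℂ[T;T⁻¹] :=
  (DirectSum.toModule ℂ ℤ (A ⊗[ℂ] ℂ[T;T⁻¹]) fun k : ℤ =>
      ((TensorProduct.mk ℂ A ℂ[T;T⁻¹]).flip (LaurentPolynomial.T k)) ∘ₗ (𝒜 k).subtype) ∘ₗ
    (DirectSum.decomposeLinearEquiv 𝒜).toLinearMap

/-- The map `A ⊗ A → A ⊗ ℂ[T;T⁻¹]`, `a' ⊗ a ↦ a' a₍₀₎ ⊗ a₍₁₎`. -/
def preCanonicalMap : A ⊗[ℂ] A →ₗ[ℂ] A ⊗[ℂ] ℂ[T;T⁻¹] :=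
  TensorProduct.lift
    ((LinearMap.mul ℂ (A ⊗[ℂ] ℂ[T;T⁻¹])).compl₁₂
      (Algebra.TensorProduct.includeLeft (R := ℂ) (S := ℂ) (A := A) (B := ℂ[T;T⁻¹])).toLinearMap
      (coaction 𝒜))

/-- The relations `a b ⊗ a' = a ⊗ b a'`, `b ∈ ℬ`, whose quotient of `A ⊗ A` is `A ⊗_ℬ A`. -/
def balancedRelations : Submodule ℂ (A ⊗[ℂ] A) :=
  Submodule.span ℂ {t | ∃ a a' : A, ∃ b ∈ 𝒜 0, t = (a * b) ⊗ₜ[ℂ] a' - a ⊗ₜ[ℂ] (b * a')}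

theorem coaction_of_mem {k : ℤ} {a : A} (ha : a ∈ 𝒜 k) :
    coaction 𝒜 a = a ⊗ₜ[ℂ] (LaurentPolynomial.T k : ℂ[T;T⁻¹]) := by
  have h : DirectSum.decomposeLinearEquiv 𝒜 a = DirectSum.lof ℂ ℤ (fun i => 𝒜 i) k ⟨a, ha⟩ :=
    DirectSum.decompose_of_mem 𝒜 ha
  simp only [coaction, LinearMap.comp_apply, LinearEquiv.coe_coe, h, DirectSum.toModule_lof]
  simp

theorem circleDeriv_of_mem {k : ℤ} {a : A} (ha : a ∈ 𝒜 k) :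
    circleDeriv 𝒜 a = (k : ℂ) • a := by
  have h : DirectSum.decomposeLinearEquiv 𝒜 a = DirectSum.lof ℂ ℤ (fun i => 𝒜 i) k ⟨a, ha⟩ :=
    DirectSum.decompose_of_mem 𝒜 ha
  simp only [circleDeriv, LinearMap.comp_apply, LinearEquiv.coe_coe, h, DirectSum.toModule_lof]
  simp

theorem coaction_mul {b : A} (hb : b ∈ 𝒜 0) (a : A) :
    coaction 𝒜 (b * a) = (b ⊗ₜ[ℂ] (1 : ℂ[T;T⁻¹])) * coaction 𝒜 a := by
  induction a using DirectSum.Decomposition.inductionOn 𝒜 with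
  | zero => simp
  | @homogeneous i m =>
    have h : b * (m : A) ∈ 𝒜 i := by
      simpa using SetLike.mul_mem_graded hb m.2
    rw [coaction_of_mem 𝒜 h, coaction_of_mem 𝒜 m.2]
    simp
  | add m n hm hn => rw [mul_add, map_add, map_add, hm, hn, mul_add]

theorem balancedRelations_le_ker : balancedRelations 𝒜 ≤ LinearMap.ker (preCanonicalMap 𝒜) := by
  refine Submodule.span_le.2 ?_
  rintro _ ⟨a, a', b, hb, rfl⟩
  simp [preCanonicalMap, coaction_mul 𝒜 hb, ← mul_assoc]

/-- The canonical map `χ : A ⊗_ℬ A → A ⊗ ℂ[T;T⁻¹]`, `χ (a' ⊗ a) = a' a₍₀₎ ⊗ a₍₁₎`. -/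
def canonicalMap : ((A ⊗[ℂ] A) ⧸ balancedRelations 𝒜) →ₗ[ℂ] A ⊗[ℂ] ℂ[T;T⁻¹] :=
  (balancedRelations 𝒜).liftQ (preCanonicalMap 𝒜) (balancedRelations_le_ker 𝒜)

/-- `ℬ = 𝒜 0 ↪ A` is a Hopf-Galois extension. -/
def IsHopfGalois : Prop := Function.Bijective (canonicalMap 𝒜)

end Bundle

/-! ### Unbounded operators

Unbounded operators on `H` are partial linear maps `H →ₗ.[ℂ] H`; sums and differences have the
intersection of the domains as their domain. -/

section Operators

variable {H : Type*} [NormedAddCommGroup H] [InnerProductSpace ℂ H]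

/-- The bounded operator `S` maps the domain of `T` into itself and `[T, S] = C` there. -/
def IsBoundedCommutator (T : H →ₗ.[ℂ] H) (S C : H →L[ℂ] H) : Prop :=
  ∀ p ∈ T.graph, (S p.1, S p.2 + C p.1) ∈ T.graph

/-- The product `S T`, on the domain of all `x ∈ dom T` with `T x ∈ dom S`. -/
def pcomp (S T : H →ₗ.[ℂ] H) : H →ₗ.[ℂ] H :=
  S.comp (T.domRestrict ((S.domain.comap T.toFun).map T.domain.subtype)) (by
    rintro ⟨_, ⟨x, hx, rfl⟩, _⟩
    exact hx)

theorem mem_graph_pcomp (S T : H →ₗ.[ℂ] H) (x z : H) :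
    (x, z) ∈ (pcomp S T).graph ↔ ∃ y, (x, y) ∈ T.graph ∧ (y, z) ∈ S.graph := by
  simp only [LinearPMap.mem_graph_iff]
  constructor
  · rintro ⟨⟨_, ⟨x, hx, rfl⟩, _⟩, rfl, rfl⟩
    exact ⟨T x, ⟨x, rfl, rfl⟩, ⟨T x, hx⟩, rfl, rfl⟩
  · rintro ⟨_, ⟨x, rfl, rfl⟩, ⟨y, hy⟩, h, rfl⟩
    subst h
    exact ⟨⟨x, ⟨x, hy, rfl⟩, x.2⟩, rfl, rfl⟩

/-- The resolvent `(T - z)⁻¹` at some point `z` of the resolvent set is a compact operator. (By the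
resolvent identity it is then compact at every point of the resolvent set.) -/
def HasCompactResolvent (T : H →ₗ.[ℂ] H) : Prop :=
  ∃ (z : ℂ) (R : H →L[ℂ] H), IsCompactOperator R ∧
    (∀ x, (R x, x + z • R x) ∈ T.graph) ∧ ∀ p ∈ T.graph, R (p.2 - z • p.1) = p.1

/-- The space `H_k` of vectors of degree `k`: `x ∈ dom δ` and `δ x = k x`. -/
def homogeneous (δ : H →ₗ.[ℂ] H) (k : ℤ) : Submodule ℂ H :=
  δ.graph.comap (LinearMap.prod LinearMap.id ((k : ℂ) • LinearMap.id))

theorem mem_homogeneous (δ : H →ₗ.[ℂ] H) (k : ℤ) (x : H) :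
    x ∈ homogeneous δ k ↔ (x, (k : ℂ) • x) ∈ δ.graph :=
  Iff.rfl

/-- The operator `J T J⁻¹` for an antiunitary operator `J`. -/
def conjBy (J : H ≃ₗᵢ⋆[ℂ] H) (T : H →L[ℂ] H) : H →L[ℂ] H :=
  (J.toContinuousLinearEquiv : H →L⋆[ℂ] H).comp
    (T.comp (J.symm.toContinuousLinearEquiv : H →L⋆[ℂ] H))

/-- The horizontal part `D_h = ½ Γ [Γ, D]` of `D`, on the domain `{x ∈ dom D | Γ x ∈ dom D}`. -/
def horizontal (Γ : H →L[ℂ] H) (D : H →ₗ.[ℂ] H) : H →ₗ.[ℂ] H :=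
  (1 / 2 : ℂ) • (Γ : H →ₗ[ℂ] H).compPMap
    ((Γ : H →ₗ[ℂ] H).compPMap D - pcomp D ((Γ : H →ₗ[ℂ] H).toPMap ⊤))

/-- The vertical part `D_v = ℓ⁻¹ Γ δ`, on the domain of `δ`. -/
def vertical (ℓ : ℝ) (Γ : H →L[ℂ] H) (δ : H →ₗ.[ℂ] H) : H →ₗ.[ℂ] H :=
  ((1 / ℓ : ℝ) : ℂ) • (Γ : H →ₗ[ℂ] H).compPMap δ

variable [CompleteSpace H]

/-- `δ` is the generator of a unitary action of `U(1)`: it is selfadjoint and `H` is the Hilbert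
space direct sum of the `H_k`, `k ∈ ℤ` (`e^{iφ}` then acts on `H_k` as `e^{ikφ}`). -/
structure IsCircleGenerator (δ : H →ₗ.[ℂ] H) : Prop where
  selfAdjoint : IsSelfAdjoint δ
  total : (⨆ k : ℤ, homogeneous δ k).topologicalClosure = ⊤

/-- `T` commutes with `δ` in the sense of unbounded operators, that is, with the `U(1)` action:
`T` commutes with the orthogonal projections onto the spaces `H_k`. -/
def CommutesWithCircle (δ T : H →ₗ.[ℂ] H) : Prop :=
  ∀ k : ℤ, ∀ p ∈ T.graph,
    ((homogeneous δ k).topologicalClosure.starProjection p.1,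
      (homogeneous δ k).topologicalClosure.starProjection p.2) ∈ T.graph

end Operators

/-! ### Spectral triples over a `U(1)` bundle -/

section SpectralTriples

variable {A : Type*} [Ring A] [StarRing A] [Algebra ℂ A]
  {H : Type*} [NormedAddCommGroup H] [InnerProductSpace ℂ H] [CompleteSpace H]

/-- `(A, D, H)` is a spectral triple. -/
structure IsSpectralTriple (π : A →⋆ₐ[ℂ] (H →L[ℂ] H)) (D : H →ₗ.[ℂ] H) : Prop where
  selfAdjoint : IsSelfAdjoint D
  bounded_commutator : ∀ a : A, ∃ C : H →L[ℂ] H, IsBoundedCommutator D (π a) C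
  compact_resolvent : HasCompactResolvent D

/-- `J` is a reality structure for `(A, D, H)`, with the signs of dimension `3`. -/
structure IsRealStructure (π : A →⋆ₐ[ℂ] (H →L[ℂ] H)) (D : H →ₗ.[ℂ] H) (J : H ≃ₗᵢ⋆[ℂ] H) :
    Prop where
  sq : ∀ x, J (J x) = -x
  comm : ∀ p ∈ D.graph, (J p.1, J p.2) ∈ D.graph
  order_zero : ∀ a b : A, Commute (π a) (conjBy J (π (star b)))
  order_one : ∀ (a b : A) (C : H →L[ℂ] H), IsBoundedCommutator D (π a) C →
    Commute C (conjBy J (π (star b)))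

/-- The data `(π, J, D)` are equivariant under the `U(1)` action generated by `δ`. -/
structure IsEquivariant (𝒜 : ℤ → Submodule ℂ A) [GradedAlgebra 𝒜] (π : A →⋆ₐ[ℂ] (H →L[ℂ] H))
    (D : H →ₗ.[ℂ] H) (J : H ≃ₗᵢ⋆[ℂ] H) (δ : H →ₗ.[ℂ] H) : Prop where
  generator : IsCircleGenerator δ
  rep : ∀ a : A, IsBoundedCommutator δ (π a) (π (circleDeriv 𝒜 a))
  real : ∀ p ∈ δ.graph, (J p.1, -(J p.2)) ∈ δ.graph
  dirac : CommutesWithCircle δ D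

/-- `Γ` makes the triple projectable along the fibres. The last condition says that `[Γ, D]` is
defined on the domain of `D`. -/
structure IsProjectable (π : A →⋆ₐ[ℂ] (H →L[ℂ] H)) (D : H →ₗ.[ℂ] H) (J : H ≃ₗᵢ⋆[ℂ] H)
    (δ : H →ₗ.[ℂ] H) (Γ : H →L[ℂ] H) : Prop where
  comm_rep : ∀ a : A, Commute Γ (π a)
  anticomm_real : ∀ x, Γ (J x) = -(J (Γ x))
  comm_circle : IsBoundedCommutator δ Γ 0
  selfAdjoint : IsSelfAdjoint Γ
  sq : Γ * Γ = 1
  domain : ∀ x ∈ D.domain, Γ x ∈ D.domain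

/-- The differential calculus is projectable along the fibres: `[D_h, b] = [D, b]`, `b ∈ ℬ`. -/
def IsProjectableCalculus (𝒜 : ℤ → Submodule ℂ A) (π : A →⋆ₐ[ℂ] (H →L[ℂ] H)) (D : H →ₗ.[ℂ] H)
    (Γ : H →L[ℂ] H) : Prop :=
  ∀ b ∈ 𝒜 0, ∀ C : H →L[ℂ] H, IsBoundedCommutator D (π b) C →
    IsBoundedCommutator (horizontal Γ D) (π b) C

/-- The operator `D - D_h - D_v` is bounded with bounded extension `Z`, and `Z` commutes with all
`J a* J⁻¹`. -/
structure IsFibreRemainder (π : A →⋆ₐ[ℂ] (H →L[ℂ] H)) (D : H →ₗ.[ℂ] H) (J : H ≃ₗᵢ⋆[ℂ] H)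
    (δ : H →ₗ.[ℂ] H) (Γ : H →L[ℂ] H) (ℓ : ℝ) (Z : H →L[ℂ] H) : Prop where
  dense : Dense ((D - horizontal Γ D - vertical ℓ Γ δ).domain : Set H)
  eq : ∀ p ∈ (D - horizontal Γ D - vertical ℓ Γ δ).graph, Z p.1 = p.2
  comm : ∀ a : A, Commute Z (conjBy J (π (star a)))

/-- The bundle has fibres of equal length `2πℓ`. -/
def HasEqualLengthFibres (π : A →⋆ₐ[ℂ] (H →L[ℂ] H)) (D : H →ₗ.[ℂ] H) (J : H ≃ₗᵢ⋆[ℂ] H)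
    (δ : H →ₗ.[ℂ] H) (Γ : H →L[ℂ] H) (ℓ : ℝ) : Prop :=
  ∃ Z : H →L[ℂ] H, IsFibreRemainder π D J δ Γ ℓ Z

/-! ### One-forms and strong connections -/

/-- The one-forms `Ω¹_D(S)`: finite sums of operators `p [D, q]` with `p, q ∈ S`. -/
def oneForms (π : A →⋆ₐ[ℂ] (H →L[ℂ] H)) (D : H →ₗ.[ℂ] H) (S : Submodule ℂ A) :
    Submodule ℂ (H →L[ℂ] H) :=
  Submodule.span ℂ {η | ∃ p ∈ S, ∃ q ∈ S, ∃ C : H →L[ℂ] H,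
    IsBoundedCommutator D (π q) C ∧ η = π p * C}

/-- The space `Ω¹_D(ℬ) A` of finite sums of operators `η a`. -/
def horizontalForms (𝒜 : ℤ → Submodule ℂ A) (π : A →⋆ₐ[ℂ] (H →L[ℂ] H)) (D : H →ₗ.[ℂ] H) :
    Submodule ℂ (H →L[ℂ] H) :=
  Submodule.span ℂ {η | ∃ θ ∈ oneForms π D (𝒜 0), ∃ a : A, η = θ * π a}

/-- The calculus is compatible with the de Rham calculus of `U(1)`:
`∑ pᵢ [D, qᵢ] = 0` implies `∑ pᵢ δ(qᵢ) = 0`. -/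
def IsCompatibleCalculus (𝒜 : ℤ → Submodule ℂ A) [GradedAlgebra 𝒜] (π : A →⋆ₐ[ℂ] (H →L[ℂ] H))
    (D : H →ₗ.[ℂ] H) : Prop :=
  ∀ (n : ℕ) (p q : Fin n → A) (C : Fin n → H →L[ℂ] H),
    (∀ i, IsBoundedCommutator D (π (q i)) (C i)) → ∑ i, π (p i) * C i = 0 →
      ∑ i, π (p i * circleDeriv 𝒜 (q i)) = 0

/-- `ω` is a strong principal connection. -/
structure IsStrongConnection (𝒜 : ℤ → Submodule ℂ A) [GradedAlgebra 𝒜]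
    (π : A →⋆ₐ[ℂ] (H →L[ℂ] H)) (D δ : H →ₗ.[ℂ] H) (ω : H →L[ℂ] H) : Prop where
  mem : ω ∈ oneForms π D ⊤
  invariant : IsBoundedCommutator δ ω 0
  vertical : ∀ (n : ℕ) (p q : Fin n → A) (C : Fin n → H →L[ℂ] H),
    (∀ i, IsBoundedCommutator D (π (q i)) (C i)) → ω = ∑ i, π (p i) * C i →
      ∑ i, π (p i * circleDeriv 𝒜 (q i)) = 1
  strong : ∀ (a : A) (C : H →L[ℂ] H), IsBoundedCommutator D (π a) C →
    C - π (circleDeriv 𝒜 a) * ω ∈ horizontalForms 𝒜 π D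

/-! ### The Dirac operator twisted by a connection -/

/-- The right action of `a ∈ A` on `H`: `h a = J a* J⁻¹ h`. -/
def rightMul (π : A →⋆ₐ[ℂ] (H →L[ℂ] H)) (J : H ≃ₗᵢ⋆[ℂ] H) (a : A) : H →L[ℂ] H :=
  conjBy J (π (star a))

/-- The right action of a one-form `η` on `H`: `h η = - J η* J⁻¹ h`. -/
def rightForm (J : H ≃ₗᵢ⋆[ℂ] H) (η : H →L[ℂ] H) : H →L[ℂ] H :=
  -(conjBy J (ContinuousLinearMap.adjoint η))

/-- The graph of `D_ω^{(k)}`, the closure of the operator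
`h p ↦ (D₀ h) p + h ∇_ω(p)`, `∇_ω(p) = [D, p] - k p ω`, where `p ∈ 𝒜 k` and `h` runs through the
domain of the restriction `D₀` of `D_h` to `H_0`. -/
def twistedGraph (𝒜 : ℤ → Submodule ℂ A) (π : A →⋆ₐ[ℂ] (H →L[ℂ] H)) (D : H →ₗ.[ℂ] H)
    (J : H ≃ₗᵢ⋆[ℂ] H) (δ : H →ₗ.[ℂ] H) (Γ ω : H →L[ℂ] H) (k : ℤ) : Submodule ℂ (H × H) :=
  (Submodule.span ℂ {g : H × H | ∃ p ∈ 𝒜 k, ∃ C : H →L[ℂ] H, IsBoundedCommutator D (π p) C ∧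
    ∃ h ∈ homogeneous δ 0, ∃ y : H, (h, y) ∈ (horizontal Γ D).graph ∧
      g = (rightMul π J p h,
        rightMul π J p y + rightForm J (C - (k : ℂ) • (π p * ω)) h)}).topologicalClosure

/-- The graph of `D_ω`, the closure of the direct sum of the operators `D_ω^{(k)}`. -/
def twistedDiracGraph (𝒜 : ℤ → Submodule ℂ A) (π : A →⋆ₐ[ℂ] (H →L[ℂ] H)) (D : H →ₗ.[ℂ] H)
    (J : H ≃ₗᵢ⋆[ℂ] H) (δ : H →ₗ.[ℂ] H) (Γ ω : H →L[ℂ] H) : Submodule ℂ (H × H) :=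
  (⨆ k : ℤ, twistedGraph 𝒜 π D J δ Γ ω k).topologicalClosure

/-- The twisted Dirac operator `D_ω` on `H`. -/
def twistedDirac (𝒜 : ℤ → Submodule ℂ A) (π : A →⋆ₐ[ℂ] (H →L[ℂ] H)) (D : H →ₗ.[ℂ] H)
    (J : H ≃ₗᵢ⋆[ℂ] H) (δ : H →ₗ.[ℂ] H) (Γ ω : H →L[ℂ] H) : H →ₗ.[ℂ] H :=
  (twistedDiracGraph 𝒜 π D J δ Γ ω).toLinearPMap

/-- The operator `𝒟_ω = Γ δ + D_ω`. -/
def fullTwistedDirac (𝒜 : ℤ → Submodule ℂ A) (π : A →⋆ₐ[ℂ] (H →L[ℂ] H)) (D : H →ₗ.[ℂ] H)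
    (J : H ≃ₗᵢ⋆[ℂ] H) (δ : H →ₗ.[ℂ] H) (Γ ω : H →L[ℂ] H) : H →ₗ.[ℂ] H :=
  (Γ : H →ₗ[ℂ] H).compPMap δ + twistedDirac 𝒜 π D J δ Γ ω

end SpectralTriples

end CircleBundle

end

open CircleBundle

/-! Write `x_k` for the component of `x` in `H_k` and `· ω` for the right action `rightForm J ω`.
Everything rests on identifying `D_ω` fibrewise: on `H_k` it is `D - Z - k (· ω)`, and `D_ω` is the
Hilbert sum of these operators (`twistedDiracGraph_eq`). On the vectors `hp` this is the Leibniz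
rule for the right action, together with `D_h = D - Z` on `H_0`. These vectors exhaust `H_k ∩ dom
D`: the Hopf–Galois condition gives `1 = ∑ aᵢ bᵢ` with `aᵢ` of degree `-k` and `bᵢ` of degree `k`,
so `x = ∑ (x aᵢ) bᵢ` with `x aᵢ ∈ H_0 ∩ dom D`. Each fibre operator is a bounded selfadjoint
perturbation of `D`, so `D_ω` is selfadjoint and commutes with the circle.

The second point is that `Γ` anticommutes with `D_ω`. By definition `Z = ½ (D + Γ D Γ) - Γ δ`, hence
`Γ (D - Z) + (D - Z) Γ = 2 δ`. Since `Z` and `Γ` commute with `A`, the same formula gives `Γ [D, q]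
+ [D, q] Γ = 2 δ(q)`; the normalisation `∑ pᵢ δ(qᵢ) = 1` then gives `Γ ω + ω Γ = 2`, and likewise
for `· ω`. On `H_k` the two contributions `2k` cancel.

The rest holds for any selfadjoint `T` of degree zero anticommuting with `Γ`. On `H_k` the sum `T +
k Γ` satisfies `‖(T + k Γ) x‖² = ‖T x‖² + k² ‖x‖²` (`norm_sq_add`). This identifies the domain of `Γ
δ + T`, makes the sum selfadjoint and bounds the tails of its resolvent; anticommutation removes the
cross terms in the square. -/

namespace CircleBundle

open Filter Topology
open scoped InnerProductSpace

/-! ### Graphs of unbounded operators and selfadjointness -/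

section PartialMaps

variable {H : Type*} [NormedAddCommGroup H] [InnerProductSpace ℂ H]

theorem mem_graph_add (f g : H →ₗ.[ℂ] H) (x z : H) :
    (x, z) ∈ (f + g).graph ↔ ∃ a b, (x, a) ∈ f.graph ∧ (x, b) ∈ g.graph ∧ z = a + b := by
  constructor
  · intro h
    obtain ⟨⟨u, hu⟩, h1, h2⟩ := (LinearPMap.mem_graph_iff _).1 h
    simp only at h1 h2
    subst h1 h2
    exact ⟨_, _, f.mem_graph ⟨u, hu.1⟩, g.mem_graph ⟨u, hu.2⟩, rfl⟩
  · rintro ⟨a, b, ha, hb, rfl⟩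
    obtain ⟨⟨u, hu⟩, h1, h2⟩ := (LinearPMap.mem_graph_iff _).1 ha
    obtain ⟨⟨v, hv⟩, h3, h4⟩ := (LinearPMap.mem_graph_iff _).1 hb
    simp only at h1 h2 h3 h4
    subst h1 h2 h3 h4
    exact (f + g).mem_graph ⟨v, hu, hv⟩

theorem mem_graph_sub (f g : H →ₗ.[ℂ] H) (x z : H) :
    (x, z) ∈ (f - g).graph ↔ ∃ a b, (x, a) ∈ f.graph ∧ (x, b) ∈ g.graph ∧ z = a - b := by
  constructor
  · intro h
    obtain ⟨⟨u, hu⟩, h1, h2⟩ := (LinearPMap.mem_graph_iff _).1 h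
    simp only at h1 h2
    subst h1 h2
    exact ⟨_, _, f.mem_graph ⟨u, hu.1⟩, g.mem_graph ⟨u, hu.2⟩, rfl⟩
  · rintro ⟨a, b, ha, hb, rfl⟩
    obtain ⟨⟨u, hu⟩, h1, h2⟩ := (LinearPMap.mem_graph_iff _).1 ha
    obtain ⟨⟨v, hv⟩, h3, h4⟩ := (LinearPMap.mem_graph_iff _).1 hb
    simp only at h1 h2 h3 h4
    subst h1 h2 h3 h4
    exact (f - g).mem_graph ⟨v, hu, hv⟩

theorem mem_graph_compPMap (S : H →ₗ[ℂ] H) (f : H →ₗ.[ℂ] H) (x z : H) :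
    (x, z) ∈ (S.compPMap f).graph ↔ ∃ y, (x, y) ∈ f.graph ∧ z = S y := by
  constructor
  · intro h
    obtain ⟨⟨u, hu⟩, h1, h2⟩ := (LinearPMap.mem_graph_iff _).1 h
    simp only at h1 h2
    subst h1 h2
    exact ⟨_, f.mem_graph ⟨u, hu⟩, rfl⟩
  · rintro ⟨y, hy, rfl⟩
    obtain ⟨⟨u, hu⟩, h1, h2⟩ := (LinearPMap.mem_graph_iff _).1 hy
    simp only at h1 h2
    subst h1 h2
    exact (S.compPMap f).mem_graph ⟨u, hu⟩

theorem mem_graph_const_smul (c : ℂ) (f : H →ₗ.[ℂ] H) (x z : H) :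
    (x, z) ∈ (c • f).graph ↔ ∃ y, (x, y) ∈ f.graph ∧ z = c • y := by
  constructor
  · intro h
    obtain ⟨⟨u, hu⟩, h1, h2⟩ := (LinearPMap.mem_graph_iff _).1 h
    simp only at h1 h2
    subst h1 h2
    exact ⟨_, f.mem_graph ⟨u, hu⟩, rfl⟩
  · rintro ⟨y, hy, rfl⟩
    obtain ⟨⟨u, hu⟩, h1, h2⟩ := (LinearPMap.mem_graph_iff _).1 hy
    simp only at h1 h2
    subst h1 h2
    exact (c • f).mem_graph ⟨u, hu⟩

theorem mem_graph_toPMap_top (S : H →ₗ[ℂ] H) (x z : H) :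
    (x, z) ∈ (S.toPMap ⊤).graph ↔ z = S x := by
  constructor
  · intro h
    obtain ⟨⟨u, hu⟩, h1, h2⟩ := (LinearPMap.mem_graph_iff _).1 h
    simp only at h1 h2
    subst h1 h2
    rfl
  · rintro rfl
    exact (S.toPMap ⊤).mem_graph ⟨x, trivial⟩

theorem mem_graph_horizontal (Γ : H →L[ℂ] H) (D : H →ₗ.[ℂ] H) (x z : H) :
    (x, z) ∈ (horizontal Γ D).graph ↔
      ∃ y y', (x, y) ∈ D.graph ∧ (Γ x, y') ∈ D.graph ∧ z = (1 / 2 : ℂ) • Γ (Γ y - y') := by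
  simp only [horizontal, mem_graph_const_smul, mem_graph_compPMap, mem_graph_sub, mem_graph_pcomp,
    mem_graph_toPMap_top]
  constructor
  · rintro ⟨_, ⟨_, ⟨_, _, ⟨y, hy, rfl⟩, ⟨_, rfl, hy'⟩, rfl⟩, rfl⟩, rfl⟩
    exact ⟨y, _, hy, hy', rfl⟩
  · rintro ⟨y, y', hy, hy', rfl⟩
    exact ⟨_, ⟨_, ⟨_, _, ⟨y, hy, rfl⟩, ⟨_, rfl, hy'⟩, rfl⟩, rfl⟩, rfl⟩

theorem mem_graph_vertical_one (Γ : H →L[ℂ] H) (δ : H →ₗ.[ℂ] H) (x z : H) :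
    (x, z) ∈ (vertical 1 Γ δ).graph ↔ ∃ w, (x, w) ∈ δ.graph ∧ z = Γ w := by
  rw [vertical, mem_graph_const_smul]
  simp only [mem_graph_compPMap]
  constructor
  · rintro ⟨_, ⟨w, hw, rfl⟩, rfl⟩
    exact ⟨w, hw, by simp⟩
  · rintro ⟨w, hw, rfl⟩
    exact ⟨_, ⟨w, hw, rfl⟩, by simp⟩

variable [CompleteSpace H]

/-- The graph of a selfadjoint operator is its own adjoint relation. -/
theorem mem_graph_iff_of_isSelfAdjoint {T : H →ₗ.[ℂ] H} (hT : IsSelfAdjoint T) (u v : H) :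
    (u, v) ∈ T.graph ↔ ∀ x y, (x, y) ∈ T.graph → inner ℂ y u = inner ℂ x v := by
  have h := LinearPMap.adjoint_graph_eq_graph_adjoint hT.dense_domain
  rw [LinearPMap.isSelfAdjoint_def.1 hT] at h
  conv_lhs => rw [h]
  simp [sub_eq_zero]

/-- Density of the domain need not be assumed: if `v` is orthogonal to the domain, the criterion
puts `(0, v)` in the graph, so `v = 0`. -/
theorem isSelfAdjoint_of_mem_graph_iff {T : H →ₗ.[ℂ] H}
    (hT : ∀ u v, (u, v) ∈ T.graph ↔ ∀ x y, (x, y) ∈ T.graph → inner ℂ y u = inner ℂ x v) :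
    IsSelfAdjoint T := by
  have hd : Dense (T.domain : Set H) := by
    rw [Submodule.dense_iff_topologicalClosure_eq_top, Submodule.topologicalClosure_eq_top_iff,
      Submodule.eq_bot_iff]
    intro v hv
    have h0 : ((0 : H), v) ∈ T.graph := by
      rw [hT]
      intro x y hxy
      rw [inner_zero_right, (Submodule.mem_orthogonal _ _).1 hv x
        (LinearPMap.mem_domain_iff.2 ⟨y, hxy⟩)]
    exact T.graph_fst_eq_zero_snd h0 rfl
  rw [LinearPMap.isSelfAdjoint_def]
  refine LinearPMap.eq_of_eq_graph ?_
  rw [LinearPMap.adjoint_graph_eq_graph_adjoint hd]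
  ext ⟨u, v⟩
  rw [hT]
  simp [sub_eq_zero]

theorem inner_graph_comm {T : H →ₗ.[ℂ] H} (hT : IsSelfAdjoint T) {x y u v : H}
    (hxy : (x, y) ∈ T.graph) (huv : (u, v) ∈ T.graph) : inner ℂ y u = inner ℂ x v :=
  (mem_graph_iff_of_isSelfAdjoint hT u v).1 huv x y hxy

theorem isClosed_graph {T : H →ₗ.[ℂ] H} (hT : IsSelfAdjoint T) :
    IsClosed (T.graph : Set (H × H)) :=
  hT.isClosed

theorem inner_comm_of_isSelfAdjoint {S : H →L[ℂ] H} (hS : IsSelfAdjoint S) (x y : H) :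
    inner ℂ (S x) y = inner ℂ x (S y) :=
  hS.isSymmetric x y

/-- Selfadjoint operators are closed under commutation with adjoints. -/
theorem IsBoundedCommutator.adjoint {T : H →ₗ.[ℂ] H} (hT : IsSelfAdjoint T) {S C : H →L[ℂ] H}
    (h : IsBoundedCommutator T S C) :
    IsBoundedCommutator T (star S) (-(star C)) := by
  rintro ⟨x, y⟩ hxy
  rw [mem_graph_iff_of_isSelfAdjoint hT]
  intro a b hab
  have h1 := inner_graph_comm hT (h _ hab) hxy
  simp only [ContinuousLinearMap.star_eq_adjoint, neg_apply, inner_add_right,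
    inner_neg_right, ContinuousLinearMap.adjoint_inner_right] at h1 ⊢
  rw [← h1, inner_add_left]
  ring

omit [CompleteSpace H] in
theorem IsBoundedCommutator.add {T : H →ₗ.[ℂ] H} {S C S' C' : H →L[ℂ] H}
    (h : IsBoundedCommutator T S C) (h' : IsBoundedCommutator T S' C') :
    IsBoundedCommutator T (S + S') (C + C') := by
  intro p hp
  have := add_mem (h p hp) (h' p hp)
  convert this using 1
  simp only [add_apply, Prod.mk_add_mk]
  congr 1
  abel

end PartialMaps

/-! ### Decomposition of `H` into the spectral subspaces of `δ` -/

section Circle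

variable {H : Type*} [NormedAddCommGroup H] [InnerProductSpace ℂ H] [CompleteSpace H]

/-- The orthogonal projection onto the vectors of degree `k`. -/
noncomputable def circleProj (δ : H →ₗ.[ℂ] H) (k : ℤ) : H →L[ℂ] H :=
  (homogeneous δ k).topologicalClosure.starProjection

variable {δ : H →ₗ.[ℂ] H} (hδ : IsCircleGenerator δ)

include hδ

theorem isClosed_homogeneous (k : ℤ) : IsClosed (homogeneous δ k : Set H) := by
  have h : (homogeneous δ k : Set H) = (fun x => (x, (k : ℂ) • x)) ⁻¹' (δ.graph : Set (H × H)) := rfl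
  rw [h]
  exact (isClosed_graph hδ.selfAdjoint).preimage (by fun_prop)

theorem topologicalClosure_homogeneous (k : ℤ) :
    (homogeneous δ k).topologicalClosure = homogeneous δ k :=
  (isClosed_homogeneous hδ k).submodule_topologicalClosure_eq

theorem circleProj_mem (k : ℤ) (x : H) : circleProj δ k x ∈ homogeneous δ k := by
  rw [← topologicalClosure_homogeneous hδ k]
  exact Submodule.starProjection_apply_mem _ x

omit hδ in
theorem circleProj_of_mem {k : ℤ} {x : H} (hx : x ∈ homogeneous δ k) : circleProj δ k x = x :=
  Submodule.starProjection_eq_self_iff.2 (Submodule.le_topologicalClosure _ hx)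

theorem inner_homogeneous_of_ne {k l : ℤ} (hkl : k ≠ l) {x y : H} (hx : x ∈ homogeneous δ k)
    (hy : y ∈ homogeneous δ l) : inner ℂ x y = 0 := by
  have h := inner_graph_comm hδ.selfAdjoint hx hy
  simp only [LinearMap.id_apply, LinearMap.smul_apply,
    inner_smul_left, inner_smul_right, map_intCast] at h
  have h' : ((k : ℂ) - l) * inner ℂ x y = 0 := by rw [sub_mul, h, sub_self]
  exact (mul_eq_zero.1 h').resolve_left (sub_ne_zero.2 (by exact_mod_cast hkl))

theorem circleProj_of_mem_of_ne {k l : ℤ} (hkl : k ≠ l) {x : H} (hx : x ∈ homogeneous δ l) :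
    circleProj δ k x = 0 := by
  refine (Submodule.starProjection_apply_eq_zero_iff _).2 ?_
  rw [topologicalClosure_homogeneous hδ, Submodule.mem_orthogonal]
  exact fun u hu => inner_homogeneous_of_ne hδ hkl hu hx

omit hδ in
theorem isSelfAdjoint_circleProj (δ : H →ₗ.[ℂ] H) (k : ℤ) : IsSelfAdjoint (circleProj δ k) :=
  isSelfAdjoint_starProjection _

theorem orthogonalFamily_homogeneous :
    OrthogonalFamily ℂ (fun k : ℤ => homogeneous δ k) fun k => (homogeneous δ k).subtypeₗᵢ := by
  intro k l hkl x y
  exact inner_homogeneous_of_ne hδ hkl x.2 y.2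

/-- Used to produce `δ x` and `δ² x` from their prescribed components once these are known to be
square summable. -/
theorem exists_circleProj_eq (c : ℤ → H) (hc : ∀ k, c k ∈ homogeneous δ k)
    (hs : Summable fun k => ‖c k‖ ^ 2) : ∃ w, HasSum c w ∧ ∀ k, circleProj δ k w = c k := by
  have h := (orthogonalFamily_homogeneous hδ).summable_iff_norm_sq_summable
    (fun k => (⟨c k, hc k⟩ : homogeneous δ k))
  obtain ⟨w, hw⟩ := h.2 (by simpa using hs)
  refine ⟨w, hw, fun k => ?_⟩
  refine (hw.mapL (circleProj δ k)).unique ?_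
  convert hasSum_single k ?_ using 1
  · exact (circleProj_of_mem (hc k)).symm
  · exact fun l hl => circleProj_of_mem_of_ne hδ (Ne.symm hl) (hc l)

theorem isHilbertSum_homogeneous :
    IsHilbertSum ℂ (fun k : ℤ => homogeneous δ k) fun k => (homogeneous δ k).subtypeₗᵢ := by
  have : ∀ k : ℤ, CompleteSpace (homogeneous δ k) := fun k =>
    (isClosed_homogeneous hδ k).completeSpace_coe
  exact IsHilbertSum.mkInternal _ (orthogonalFamily_homogeneous hδ) hδ.total.ge

theorem hasSum_circleProj (x : H) : HasSum (fun k => circleProj δ k x) x := by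
  have h := isHilbertSum_homogeneous hδ
  have h1 := h.hasSum_linearIsometryEquiv_symm (h.linearIsometryEquiv x)
  simp only [LinearIsometryEquiv.symm_apply_apply] at h1
  convert h1 using 1
  ext k
  refine (h1.mapL (circleProj δ k)).unique ?_
  convert hasSum_single k ?_ using 1
  · exact (circleProj_of_mem (Subtype.mem _)).symm
  · exact fun l hl => circleProj_of_mem_of_ne hδ (Ne.symm hl) (Subtype.mem _)

theorem hasSum_norm_sq_circleProj (x : H) :
    HasSum (fun k => ‖circleProj δ k x‖ ^ 2) (‖x‖ ^ 2) := by
  have h := (hasSum_circleProj hδ x).mapL (innerSL ℂ x)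
  have h2 := Complex.hasSum_re h
  convert h2 using 1
  · ext k
    simp only [innerSL_apply_apply]
    rw [← circleProj_of_mem (circleProj_mem hδ k x),
      ← inner_comm_of_isSelfAdjoint (isSelfAdjoint_circleProj δ k),
      circleProj_of_mem (circleProj_mem hδ k x)]
    simp [← inner_self_eq_norm_sq (𝕜 := ℂ)]
  · simp [← inner_self_eq_norm_sq (𝕜 := ℂ)]

theorem eq_of_circleProj_eq {x y : H} (h : ∀ k, circleProj δ k x = circleProj δ k y) : x = y :=
  (hasSum_circleProj hδ x).unique (by simpa only [h] using hasSum_circleProj hδ y)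

theorem circleProj_circleProj_self (k : ℤ) (x : H) :
    circleProj δ k (circleProj δ k x) = circleProj δ k x :=
  circleProj_of_mem (circleProj_mem hδ k x)

theorem circleProj_circleProj_of_ne {k l : ℤ} (hkl : k ≠ l) (x : H) :
    circleProj δ k (circleProj δ l x) = 0 :=
  circleProj_of_mem_of_ne hδ hkl (circleProj_mem hδ l x)

/-- `δ` is diagonal with its maximal domain. One direction pairs with homogeneous vectors; the other
uses that the finite partial sums lie in the closed graph of `δ`. -/
theorem mem_graph_iff_circleProj (x w : H) :
    (x, w) ∈ δ.graph ↔ ∀ k, circleProj δ k w = (k : ℂ) • circleProj δ k x := by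
  constructor
  · intro h k
    refine ext_inner_left ℂ fun v => ?_
    rw [← inner_comm_of_isSelfAdjoint (isSelfAdjoint_circleProj δ k), inner_smul_right,
      ← inner_comm_of_isSelfAdjoint (isSelfAdjoint_circleProj δ k)]
    have := inner_graph_comm hδ.selfAdjoint (circleProj_mem hδ k v) h
    simpa [inner_smul_left, mul_comm] using this.symm
  · intro h
    have h1 : HasSum (fun k => (circleProj δ k x, circleProj δ k w)) (x, w) :=
      (hasSum_circleProj hδ x).prodMk (hasSum_circleProj hδ w)
    refine (isClosed_graph hδ.selfAdjoint).mem_of_tendsto h1 (Eventually.of_forall fun s => ?_)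
    refine sum_mem fun k _ => ?_
    rw [h k]
    exact circleProj_mem hδ k x

/-- A continuous additive map which shifts degrees intertwines the projections. -/
theorem circleProj_map_of_mem {f : H →+ H} (hf : Continuous f) {σ : ℤ → ℤ}
    (hσ : Function.Injective σ) (h : ∀ k, ∀ x ∈ homogeneous δ k, f x ∈ homogeneous δ (σ k))
    (k : ℤ) (x : H) : circleProj δ (σ k) (f x) = f (circleProj δ k x) := by
  have h1 := ((hasSum_circleProj hδ x).map f hf).mapL (circleProj δ (σ k))
  refine h1.unique ?_
  convert hasSum_single k ?_ using 1
  · exact (circleProj_of_mem (h k _ (circleProj_mem hδ k x))).symm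
  · exact fun l hl => circleProj_of_mem_of_ne hδ (fun e => hl (hσ e).symm)
      (h l _ (circleProj_mem hδ l x))

theorem circleProj_apply_of_isBoundedCommutator {S : H →L[ℂ] H} {j : ℤ}
    (hS : IsBoundedCommutator δ S ((j : ℂ) • S)) (k : ℤ) (x : H) :
    circleProj δ (k + j) (S x) = S (circleProj δ k x) := by
  refine circleProj_map_of_mem hδ (f := (S : H →ₗ[ℂ] H).toAddMonoidHom) S.continuous
    (σ := fun k => k + j) (add_left_injective j) (fun k x hx => ?_) k x
  have := hS _ hx
  simpa [mem_homogeneous, add_smul] using this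

theorem commute_circleProj_of_isBoundedCommutator {S : H →L[ℂ] H}
    (hS : IsBoundedCommutator δ S 0) (k : ℤ) (x : H) :
    circleProj δ k (S x) = S (circleProj δ k x) := by
  simpa using circleProj_apply_of_isBoundedCommutator hδ (j := 0) (S := S) (by simpa using hS) k x

end Circle

/-! ### Hilbert sums of bounded perturbations of `D` on the spaces `H_k` -/

section Perturbation

variable {H : Type*} [NormedAddCommGroup H] [InnerProductSpace ℂ H] [CompleteSpace H]

/-- The Hilbert space direct sum of the operators `D + B k` on the spaces `H_k`. -/
noncomputable def perturbedGraph (δ D : H →ₗ.[ℂ] H) (B : ℤ → H →L[ℂ] H) : Submodule ℂ (H × H) :=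
  ⨅ k : ℤ, D.graph.comap
    (((circleProj δ k).comp (ContinuousLinearMap.fst ℂ H H)).prod
      ((circleProj δ k).comp (ContinuousLinearMap.snd ℂ H H) -
        (B k).comp ((circleProj δ k).comp (ContinuousLinearMap.fst ℂ H H)))).toLinearMap

theorem mem_perturbedGraph {δ D : H →ₗ.[ℂ] H} {B : ℤ → H →L[ℂ] H} {x y : H} :
    (x, y) ∈ perturbedGraph δ D B ↔
      ∀ k, (circleProj δ k x, circleProj δ k y - B k (circleProj δ k x)) ∈ D.graph := by
  simp only [perturbedGraph, Submodule.mem_iInf, Submodule.mem_comap]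
  rfl

/-- `B` is a family of selfadjoint degree preserving perturbations of a selfadjoint operator `D`
which commutes with the circle action. -/
structure IsFibrePerturbation (δ D : H →ₗ.[ℂ] H) (B : ℤ → H →L[ℂ] H) : Prop where
  generator : IsCircleGenerator δ
  selfAdjoint_op : IsSelfAdjoint D
  comm_op : CommutesWithCircle δ D
  selfAdjoint : ∀ k, IsSelfAdjoint (B k)
  comm : ∀ k l x, circleProj δ l (B k x) = B k (circleProj δ l x)

theorem CommutesWithCircle.circleProj_mem {δ D : H →ₗ.[ℂ] H} (h : CommutesWithCircle δ D) (k : ℤ)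
    {x y : H} (hxy : (x, y) ∈ D.graph) : (circleProj δ k x, circleProj δ k y) ∈ D.graph :=
  h k _ hxy

/-- A closed relation containing all homogeneous components of a pair contains the pair. -/
theorem mem_of_circleProj_mem {δ : H →ₗ.[ℂ] H} (hδ : IsCircleGenerator δ)
    (G : Submodule ℂ (H × H)) {x y : H}
    (h : ∀ k, (circleProj δ k x, circleProj δ k y) ∈ G) : (x, y) ∈ G.topologicalClosure := by
  have h1 : HasSum (fun k => (circleProj δ k x, circleProj δ k y)) (x, y) :=
    (hasSum_circleProj hδ x).prodMk (hasSum_circleProj hδ y)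
  exact G.isClosed_topologicalClosure.mem_of_tendsto h1
    (Eventually.of_forall fun s => G.le_topologicalClosure (sum_mem fun k _ => h k))

theorem mem_graph_of_circleProj_mem {δ T : H →ₗ.[ℂ] H} (hδ : IsCircleGenerator δ)
    (hT : IsSelfAdjoint T) {x y : H}
    (h : ∀ k, (circleProj δ k x, circleProj δ k y) ∈ T.graph) : (x, y) ∈ T.graph := by
  have := mem_of_circleProj_mem hδ _ h
  rwa [(isClosed_graph hT).submodule_topologicalClosure_eq] at this

namespace IsFibrePerturbation

variable {δ D : H →ₗ.[ℂ] H} {B : ℤ → H →L[ℂ] H} (hB : IsFibrePerturbation δ D B)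

include hB

theorem mem_of_homogeneous {k : ℤ} {x y : H} (hx : x ∈ homogeneous δ k)
    (hxy : (x, y - B k x) ∈ D.graph) : (x, y) ∈ perturbedGraph δ D B := by
  have h1 := hB.comm_op.circleProj_mem k hxy
  rw [map_sub, hB.comm, circleProj_of_mem hx] at h1
  -- `D` and `B k` both preserve degree, so the value at a vector of `H_k` must lie in `H_k`; all
  -- other components of the pair then vanish.
  have h2 : circleProj δ k y = y := sub_left_injective (D.mem_graph_snd_inj h1 hxy rfl)
  have hy : y ∈ homogeneous δ k := h2 ▸ circleProj_mem hB.generator k y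
  rw [mem_perturbedGraph]
  intro l
  by_cases hl : l = k
  · rwa [hl, h2, circleProj_of_mem hx]
  · rw [circleProj_of_mem_of_ne hB.generator hl hx, circleProj_of_mem_of_ne hB.generator hl hy,
      map_zero, sub_zero]
    exact zero_mem _

theorem circleProj_mem (k : ℤ) {x y : H} (hxy : (x, y) ∈ perturbedGraph δ D B) :
    (circleProj δ k x, circleProj δ k y) ∈ perturbedGraph δ D B :=
  hB.mem_of_homogeneous (CircleBundle.circleProj_mem hB.generator k x)
    (mem_perturbedGraph.1 hxy k)

theorem isClosed : IsClosed (perturbedGraph δ D B : Set (H × H)) := by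
  have : (perturbedGraph δ D B : Set (H × H)) = ⋂ k : ℤ,
      (fun p : H × H => (circleProj δ k p.1, circleProj δ k p.2 - B k (circleProj δ k p.1))) ⁻¹'
        (D.graph : Set (H × H)) := by
    ext ⟨x, y⟩
    simp [mem_perturbedGraph]
  rw [this]
  exact isClosed_iInter fun k => (isClosed_graph hB.selfAdjoint_op).preimage (by fun_prop)

/-- Symmetry is summed over the fibres. Conversely, testing only against homogeneous pairs recovers
the adjoint condition for `D` in each fibre, and `D` is selfadjoint. -/
theorem mem_iff_inner (u v : H) : (u, v) ∈ perturbedGraph δ D B ↔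
    ∀ x y, (x, y) ∈ perturbedGraph δ D B → inner ℂ y u = inner ℂ x v := by
  have hP := fun k => inner_comm_of_isSelfAdjoint (isSelfAdjoint_circleProj δ k)
  constructor
  · intro huv x y hxy
    have h1 := (hasSum_circleProj hB.generator u).mapL (innerSL ℂ y)
    have h2 := (hasSum_circleProj hB.generator v).mapL (innerSL ℂ x)
    simp only [innerSL_apply_apply] at h1 h2
    refine h1.unique ?_
    convert h2 using 1
    ext k
    have h := inner_graph_comm hB.selfAdjoint_op (mem_perturbedGraph.1 hxy k)
      (mem_perturbedGraph.1 huv k)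
    rw [inner_sub_left, inner_sub_right, inner_comm_of_isSelfAdjoint (hB.selfAdjoint k),
      sub_left_inj, hP, hP, circleProj_circleProj_self hB.generator,
      circleProj_circleProj_self hB.generator] at h
    exact h
  · intro h
    rw [mem_perturbedGraph]
    intro k
    rw [mem_graph_iff_of_isSelfAdjoint hB.selfAdjoint_op]
    intro a b hab
    -- For an arbitrary `(a, b)` in the graph of `D`, the test pair is its degree `k` part,
    -- corrected by `B k`.
    have h1 := h (circleProj δ k a) (circleProj δ k b + B k (circleProj δ k a))
      (hB.mem_of_homogeneous (CircleBundle.circleProj_mem hB.generator k a)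
        (by simpa using hB.comm_op.circleProj_mem k hab))
    rw [inner_add_left, hP, hP, inner_comm_of_isSelfAdjoint (hB.selfAdjoint k), hP, hB.comm] at h1
    rw [inner_sub_right, ← h1]
    ring

theorem toLinearPMap_graph :
    (perturbedGraph δ D B).toLinearPMap.graph = perturbedGraph δ D B := by
  refine Submodule.toLinearPMap_graph_eq _ ?_
  rintro ⟨x, y⟩ hxy (rfl : x = 0)
  refine eq_of_circleProj_eq hB.generator fun k => ?_
  have := mem_perturbedGraph.1 hxy k
  rw [map_zero, map_zero, sub_zero] at this
  simpa using D.graph_fst_eq_zero_snd this rfl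

theorem isSelfAdjoint {T : H →ₗ.[ℂ] H} (hT : T.graph = perturbedGraph δ D B) :
    IsSelfAdjoint T :=
  isSelfAdjoint_of_mem_graph_iff (by rw [hT]; exact hB.mem_iff_inner)

theorem commutesWithCircle {T : H →ₗ.[ℂ] H} (hT : T.graph = perturbedGraph δ D B) :
    CommutesWithCircle δ T := by
  rintro k ⟨x, y⟩ hxy
  rw [hT] at hxy ⊢
  exact hB.circleProj_mem k hxy

end IsFibrePerturbation

end Perturbation

/-! ### The resolvent of a selfadjoint operator at `i` -/

section Resolvent

variable {H : Type*} [NormedAddCommGroup H] [InnerProductSpace ℂ H] [CompleteSpace H]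

/-- The cross term is the imaginary part of `⟨y, x⟩`, which is zero by symmetry. Hence `T - i` is
bounded below by the graph norm. -/
theorem norm_sq_sub_I_smul {T : H →ₗ.[ℂ] H} (hT : IsSelfAdjoint T) {x y : H}
    (hxy : (x, y) ∈ T.graph) : ‖y - Complex.I • x‖ ^ 2 = ‖y‖ ^ 2 + ‖x‖ ^ 2 := by
  have h := inner_graph_comm hT hxy hxy
  have h2 : (inner ℂ y x).im = 0 := by
    rw [← inner_conj_symm, ← h, ← Complex.conj_eq_iff_im, inner_conj_symm, inner_conj_symm, h]
  rw [@norm_sub_sq ℂ, norm_smul, Complex.norm_I, one_mul, inner_smul_right]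
  simp [h2]

/-- The resolvent of a selfadjoint operator at `i`. -/
theorem exists_resolvent {T : H →ₗ.[ℂ] H} (hT : IsSelfAdjoint T) :
    ∃ R : H →L[ℂ] H, (∀ x, (R x, x + Complex.I • R x) ∈ T.graph) ∧
      ∀ p ∈ T.graph, R (p.2 - Complex.I • p.1) = p.1 := by
  have : CompleteSpace T.graph := (isClosed_graph hT).completeSpace_coe
  let f : T.graph →L[ℂ] H :=
    (ContinuousLinearMap.snd ℂ H H - Complex.I • ContinuousLinearMap.fst ℂ H H).comp
      T.graph.subtypeL
  have hf : ∀ p : T.graph, f p = (p : H × H).2 - Complex.I • (p : H × H).1 := fun p => rfl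
  have hnorm : ∀ p : T.graph, ‖p‖ ≤ ‖f p‖ := by
    rintro ⟨⟨x, y⟩, hp⟩
    have h := norm_sq_sub_I_smul hT hp
    rw [hf]
    refine max_le ?_ ?_ <;> refine le_of_sq_le_sq ?_ (norm_nonneg _) <;> rw [h]
    · exact le_add_of_nonneg_left (sq_nonneg ‖y‖)
    · exact le_add_of_nonneg_right (sq_nonneg ‖x‖)
  have hanti : AntilipschitzWith 1 f := f.antilipschitz_of_bound (by simpa using hnorm)
  have hinj : LinearMap.ker (f : T.graph →ₗ[ℂ] H) = ⊥ := LinearMap.ker_eq_bot.2 hanti.injective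
  have hcl : IsClosed (Set.range f) := hanti.isClosed_range f.uniformContinuous
  have hsurj : LinearMap.range (f : T.graph →ₗ[ℂ] H) = ⊤ := by
    rw [← IsClosed.submodule_topologicalClosure_eq (s := LinearMap.range (f : T.graph →ₗ[ℂ] H)) hcl,
      Submodule.topologicalClosure_eq_top_iff, Submodule.eq_bot_iff]
    intro u hu
    -- A vector orthogonal to the range of `T - i` is an eigenvector of `T* = T` with eigenvalue
    -- `-i`, which symmetry excludes unless it is zero.
    have h1 : (u, -(Complex.I • u)) ∈ T.graph := by
      rw [mem_graph_iff_of_isSelfAdjoint hT]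
      intro x y hxy
      have := (Submodule.mem_orthogonal _ _).1 hu _ ⟨⟨(x, y), hxy⟩, rfl⟩
      change inner ℂ (y - Complex.I • x) u = 0 at this
      rw [inner_sub_left, inner_smul_left, Complex.conj_I, sub_eq_zero] at this
      rw [this, inner_neg_right, inner_smul_right]
      ring
    have h2 := inner_graph_comm hT h1 h1
    rw [inner_neg_left, inner_neg_right, inner_smul_left, inner_smul_right, Complex.conj_I] at h2
    have h3 : Complex.I * inner ℂ u u = 0 := by linear_combination h2 / 2
    exact inner_self_eq_zero.1 ((mul_eq_zero.1 h3).resolve_left Complex.I_ne_zero)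
  let e := ContinuousLinearEquiv.ofBijective f hinj hsurj
  refine ⟨(ContinuousLinearMap.fst ℂ H H).comp (T.graph.subtypeL.comp e.symm.toContinuousLinearMap),
    fun x => ?_, fun p hp => ?_⟩
  · have h1 : f (e.symm x) = x := e.apply_symm_apply x
    have h2 := (e.symm x).2
    convert h2 using 1
    refine Prod.ext rfl ?_
    change x + Complex.I • (e.symm x : H × H).1 = (e.symm x : H × H).2
    rw [hf] at h1
    nth_rw 1 [← h1]
    exact sub_add_cancel _ _
  · have h1 : e.symm (f ⟨p, hp⟩) = ⟨p, hp⟩ := e.symm_apply_apply _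
    change (e.symm (f ⟨p, hp⟩) : H × H).1 = p.1
    rw [h1]

end Resolvent

/-! ### The operator `Γ δ + T` for `T` anticommuting with `Γ` -/

section OddOperators

variable {H : Type*} [NormedAddCommGroup H] [InnerProductSpace ℂ H] [CompleteSpace H]

/-- `T` is a selfadjoint operator of degree zero which anticommutes with the degree preserving
selfadjoint symmetry `Γ`. -/
structure IsOddCircleOperator (δ T : H →ₗ.[ℂ] H) (Γ : H →L[ℂ] H) : Prop where
  generator : IsCircleGenerator δ
  selfAdjoint_op : IsSelfAdjoint T
  comm_op : CommutesWithCircle δ T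
  selfAdjoint : IsSelfAdjoint Γ
  sq : Γ * Γ = 1
  comm_circle : IsBoundedCommutator δ Γ 0
  anticomm : ∀ p ∈ T.graph, (Γ p.1, -(Γ p.2)) ∈ T.graph

/-- The operator `Γ δ + T`. -/
noncomputable def circleSum (δ T : H →ₗ.[ℂ] H) (Γ : H →L[ℂ] H) : H →ₗ.[ℂ] H :=
  (Γ : H →ₗ[ℂ] H).compPMap δ + T

omit [CompleteSpace H] in
theorem mem_graph_circleSum {δ T : H →ₗ.[ℂ] H} {Γ : H →L[ℂ] H} {x z : H} :
    (x, z) ∈ (circleSum δ T Γ).graph ↔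
      ∃ w y, (x, w) ∈ δ.graph ∧ (x, y) ∈ T.graph ∧ z = Γ w + y := by
  simp only [circleSum, mem_graph_add, mem_graph_compPMap]
  constructor
  · rintro ⟨_, y, ⟨w, hw, rfl⟩, hy, rfl⟩
    exact ⟨w, y, hw, hy, rfl⟩
  · rintro ⟨w, y, hw, hy, rfl⟩
    exact ⟨_, y, ⟨w, hw, rfl⟩, hy, rfl⟩

-- Intended for `c = k²` and the degree `k` components of `x` and `z = (Γ δ + T)² x`, where `z - c
-- x` is the component of `T² x`. Expanding `‖c x + (z - c x)‖²` leaves only nonnegative extra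
-- terms.
omit [CompleteSpace H] in
theorem norm_sq_real_smul_le {c : ℝ} (hc : 0 ≤ c) {d : ℂ} {x z : H}
    (h : 0 ≤ (inner ℂ x (z - d • x)).re) (hd : d = c) : ‖d • x‖ ^ 2 ≤ ‖z‖ ^ 2 := by
  subst hd
  have h1 : ‖z‖ ^ 2 = ‖(c : ℂ) • x + (z - (c : ℂ) • x)‖ ^ 2 := by rw [add_sub_cancel]
  rw [h1, @norm_add_sq ℂ, inner_smul_left, Complex.conj_ofReal]
  have h2 : 0 ≤ 2 * RCLike.re ((c : ℂ) * inner ℂ x (z - (c : ℂ) • x)) := by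
    simpa [Complex.re_ofReal_mul] using mul_nonneg hc h
  nlinarith [sq_nonneg ‖z - (c : ℂ) • x‖]

namespace IsOddCircleOperator

variable {δ T : H →ₗ.[ℂ] H} {Γ : H →L[ℂ] H} (h : IsOddCircleOperator δ T Γ)

include h

theorem sq_apply (x : H) : Γ (Γ x) = x := by
  simpa using congrArg (fun S : H →L[ℂ] H => S x) h.sq

theorem circleProj_comm (k : ℤ) (x : H) : circleProj δ k (Γ x) = Γ (circleProj δ k x) :=
  commute_circleProj_of_isBoundedCommutator h.generator h.comm_circle k x

theorem mem_graph_delta {x w : H} (hw : (x, w) ∈ δ.graph) : (Γ x, Γ w) ∈ δ.graph := by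
  simpa using h.comm_circle _ hw

theorem isFibrePerturbation : IsFibrePerturbation δ T fun k => (k : ℂ) • Γ where
  generator := h.generator
  selfAdjoint_op := h.selfAdjoint_op
  comm_op := h.comm_op
  selfAdjoint k := by
    rw [isSelfAdjoint_iff, star_smul, h.selfAdjoint.star_eq]
    simp
  comm k l x := by simp [h.circleProj_comm]

theorem norm_apply (x : H) : ‖Γ x‖ = ‖x‖ := by
  have h1 : inner ℂ (Γ x) (Γ x) = inner ℂ x x := by
    rw [inner_comm_of_isSelfAdjoint h.selfAdjoint, h.sq_apply]
  rw [@norm_eq_sqrt_re_inner ℂ, h1, ← @norm_eq_sqrt_re_inner ℂ]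

/-- Anticommutation and symmetry make `⟨y, Γ x⟩` minus its own conjugate, so the real cross term
vanishes. -/
theorem norm_sq_add {x y : H} (hxy : (x, y) ∈ T.graph) (k : ℤ) :
    ‖y + (k : ℂ) • Γ x‖ ^ 2 = ‖y‖ ^ 2 + (k : ℝ) ^ 2 * ‖x‖ ^ 2 := by
  have h1 := inner_graph_comm h.selfAdjoint_op hxy (h.anticomm _ hxy)
  have h2 : (inner ℂ y (Γ x)).re = 0 := by
    have h3 : inner ℂ y (Γ x) = -conj (inner ℂ y (Γ x)) := by
      rw [inner_conj_symm, inner_comm_of_isSelfAdjoint h.selfAdjoint]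
      simpa using h1
    have := congrArg Complex.re h3
    simp only [Complex.neg_re, Complex.conj_re] at this
    linarith
  rw [@norm_add_sq ℂ, norm_smul, h.norm_apply, inner_smul_right, mul_pow]
  simp [h2]

/-- The point is that the sum on `dom δ ∩ dom T` is already the full Hilbert sum of the `T + k Γ`:
by `norm_sq_add`, `k² ‖x_k‖² ≤ ‖z_k‖²`, so a vector in the domain of the Hilbert sum lies in `dom
δ`, and then in `dom T`. -/
theorem graph_circleSum :
    (circleSum δ T Γ).graph = perturbedGraph δ T fun k => (k : ℂ) • Γ := by
  ext ⟨x, z⟩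
  rw [mem_graph_circleSum, mem_perturbedGraph]
  constructor
  · rintro ⟨w, y, hw, hy, rfl⟩ k
    have := h.comm_op.circleProj_mem k hy
    rw [map_add, h.circleProj_comm, (mem_graph_iff_circleProj h.generator _ _).1 hw]
    simpa using this
  · intro hxz
    obtain ⟨w, -, hw⟩ := exists_circleProj_eq h.generator (fun k => (k : ℂ) • circleProj δ k x)
      (fun k => Submodule.smul_mem _ _ (circleProj_mem h.generator k x)) (by
        refine Summable.of_nonneg_of_le (fun k => sq_nonneg _) (fun k => ?_)
          (hasSum_norm_sq_circleProj h.generator z).summable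
        have h1 := h.norm_sq_add (hxz k) k
        simp only [smul_apply, sub_add_cancel] at h1
        rw [h1, norm_smul, mul_pow, Complex.norm_intCast, sq_abs]
        exact le_add_of_nonneg_left (sq_nonneg _))
    refine ⟨w, z - Γ w, (mem_graph_iff_circleProj h.generator _ _).2 hw, ?_, by abel⟩
    refine mem_graph_of_circleProj_mem h.generator h.selfAdjoint_op fun k => ?_
    rw [map_sub, h.circleProj_comm, hw, map_smul]
    exact hxz k

theorem isSelfAdjoint_circleSum : IsSelfAdjoint (circleSum δ T Γ) :=
  h.isFibrePerturbation.isSelfAdjoint h.graph_circleSum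

theorem commutesWithCircle_circleSum : CommutesWithCircle δ (circleSum δ T Γ) :=
  h.isFibrePerturbation.commutesWithCircle h.graph_circleSum

theorem mem_graph_circleSum_symmetry {x w y : H} (hw : (x, w) ∈ δ.graph)
    (hy : (x, y) ∈ T.graph) : (Γ x, w - Γ y) ∈ (circleSum δ T Γ).graph :=
  mem_graph_circleSum.2 ⟨Γ w, -(Γ y), h.mem_graph_delta hw, h.anticomm _ hy, by
    rw [h.sq_apply, sub_eq_add_neg]⟩

theorem apply_mem_domain_circleSum (x : H) (hx : x ∈ (circleSum δ T Γ).domain) :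
    Γ x ∈ (circleSum δ T Γ).domain := by
  obtain ⟨z, hz⟩ := LinearPMap.mem_domain_iff.1 hx
  obtain ⟨w, y, hw, hy, rfl⟩ := mem_graph_circleSum.1 hz
  exact LinearPMap.mem_domain_iff.2 ⟨_, h.mem_graph_circleSum_symmetry hw hy⟩

/-- The horizontal part of `Γ δ + T` is the restriction of `T` to the domain of `δ`. -/
theorem mem_graph_horizontal_circleSum {x y : H} :
    (x, y) ∈ (horizontal Γ (circleSum δ T Γ)).graph ↔ x ∈ δ.domain ∧ (x, y) ∈ T.graph := by
  -- Here `w = δ x` and `y = T x`: the operator sends `x` to `Γ w + y` and `Γ x` to `w - Γ y`.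
  have key : ∀ w y : H, (1 / 2 : ℂ) • Γ (Γ (Γ w + y) - (w - Γ y)) = y := by
    intro w y
    rw [map_add, h.sq_apply, ← map_smul]
    have : (1 / 2 : ℂ) • (w + Γ y - (w - Γ y)) = Γ y := by module
    rw [this, h.sq_apply]
  rw [mem_graph_horizontal]
  constructor
  · rintro ⟨z, z', hz, hz', rfl⟩
    obtain ⟨w, y, hw, hy, rfl⟩ := mem_graph_circleSum.1 hz
    rw [(circleSum δ T Γ).mem_graph_snd_inj hz' (h.mem_graph_circleSum_symmetry hw hy) rfl, key]
    exact ⟨LinearPMap.mem_domain_iff.2 ⟨w, hw⟩, hy⟩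
  · rintro ⟨hx, hy⟩
    obtain ⟨w, hw⟩ := LinearPMap.mem_domain_iff.1 hx
    exact ⟨_, _, mem_graph_circleSum.2 ⟨w, y, hw, hy, rfl⟩, h.mem_graph_circleSum_symmetry hw hy,
      (key w y).symm⟩

theorem horizontal_circleSum_le : horizontal Γ (circleSum δ T Γ) ≤ T :=
  LinearPMap.le_of_le_graph fun _ hp => (h.mem_graph_horizontal_circleSum.1 hp).2

theorem domain_horizontal_circleSum :
    (horizontal Γ (circleSum δ T Γ)).domain = (circleSum δ T Γ).domain := by
  ext x
  simp only [LinearPMap.mem_domain_iff, h.mem_graph_horizontal_circleSum, mem_graph_circleSum]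
  constructor
  · rintro ⟨y, ⟨w, hw⟩, hy⟩
    exact ⟨_, w, y, hw, hy, rfl⟩
  · rintro ⟨_, w, y, hw, hy, rfl⟩
    exact ⟨y, ⟨w, hw⟩, hy⟩

/-- Homogeneous vectors lie in `dom δ`, so the restriction of `T` to `dom δ ∩ dom T` contains all
homogeneous components of the graph of `T`, and these determine its closure. -/
theorem closure_horizontal_circleSum : (horizontal Γ (circleSum δ T Γ)).closure = T := by
  have hcl : T.IsClosed := h.selfAdjoint_op.isClosed
  have hc : (horizontal Γ (circleSum δ T Γ)).IsClosable :=
    hcl.isClosable.leIsClosable h.horizontal_circleSum_le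
  refine LinearPMap.eq_of_eq_graph ?_
  rw [← hc.graph_closure_eq_closure_graph]
  refine le_antisymm ?_ ?_
  · exact Submodule.topologicalClosure_minimal _
      (fun p hp => (h.mem_graph_horizontal_circleSum.1 hp).2) hcl
  · rintro ⟨x, y⟩ hxy
    refine mem_of_circleProj_mem h.generator _ fun k => h.mem_graph_horizontal_circleSum.2
      ⟨LinearPMap.mem_domain_iff.2 ⟨_, circleProj_mem h.generator k x⟩,
        h.comm_op.circleProj_mem k hxy⟩

theorem mem_graph_pcomp_circleSum_iff {x z : H} :
    (x, z) ∈ (pcomp (circleSum δ T Γ) (circleSum δ T Γ)).graph ↔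
      (x, z) ∈ (pcomp T T + pcomp δ δ).graph := by
  rw [mem_graph_pcomp, mem_graph_add]
  simp only [mem_graph_pcomp]
  constructor
  · rintro ⟨y, hxy, hyz⟩
    obtain ⟨w, u, hw, hu, rfl⟩ := mem_graph_circleSum.1 hxy
    have hwk := (mem_graph_iff_circleProj h.generator _ _).1 hw
    -- In degree `k`, `(T + k Γ)(u_k + k Γ x_k) = z_k`. Subtracting `k T Γ x_k = -k Γ u_k` shows
    -- `u_k ∈ dom T` with `T u_k = z_k - k² x_k`.
    have hfib : ∀ k, (circleProj δ k u,
        circleProj δ k z - ((k : ℂ) ^ 2) • circleProj δ k x) ∈ T.graph := by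
      intro k
      rw [h.graph_circleSum, mem_perturbedGraph] at hyz
      have h1 := hyz k
      have h2 := T.graph.smul_mem (k : ℂ) (h.anticomm _ (h.comm_op.circleProj_mem k hu))
      have h3 := sub_mem h1 h2
      rw [map_add, h.circleProj_comm, hwk] at h3
      convert h3 using 1
      simp only [Prod.smul_mk, Prod.mk_sub_mk, map_add, map_smul, smul_apply,
        h.sq_apply]
      congr 1 <;> module
    obtain ⟨v, -, hv⟩ := exists_circleProj_eq h.generator
      (fun k => ((k : ℂ) ^ 2) • circleProj δ k x)
      (fun k => Submodule.smul_mem _ _ (circleProj_mem h.generator k x)) (by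
        refine Summable.of_nonneg_of_le (fun k => sq_nonneg _) (fun k => ?_)
          (hasSum_norm_sq_circleProj h.generator z).summable
        -- `⟨x_k, T² x_k⟩ = ‖T x_k‖² ≥ 0` gives `k⁴ ‖x_k‖² ≤ ‖z_k‖²`, so the components `k² x_k` sum
        -- to `δ² x`.
        have h1 := inner_graph_comm h.selfAdjoint_op (h.comm_op.circleProj_mem k hu) (hfib k)
        refine norm_sq_real_smul_le (sq_nonneg (k : ℝ)) ?_ (by push_cast; rfl)
        rw [← h1]
        exact inner_self_nonneg (𝕜 := ℂ))
    refine ⟨z - v, v, ⟨u, hu, ?_⟩, ⟨w, hw, ?_⟩, by abel⟩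
    · refine mem_graph_of_circleProj_mem h.generator h.selfAdjoint_op fun k => ?_
      rw [map_sub, hv]
      exact hfib k
    · rw [mem_graph_iff_circleProj h.generator]
      intro k
      rw [hv, hwk, smul_smul, pow_two]
  · rintro ⟨v, w', ⟨u, hu, huv⟩, ⟨w, hw, hww⟩, rfl⟩
    refine ⟨Γ w + u, mem_graph_circleSum.2 ⟨w, u, hw, hu, rfl⟩, ?_⟩
    rw [h.graph_circleSum, mem_perturbedGraph]
    intro k
    have h2 := T.graph.smul_mem (k : ℂ) (h.anticomm _ (h.comm_op.circleProj_mem k hu))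
    have h3 := add_mem (h.comm_op.circleProj_mem k huv) h2
    have hwk := (mem_graph_iff_circleProj h.generator _ _).1 hw k
    have hwk' := (mem_graph_iff_circleProj h.generator _ _).1 hww k
    convert h3 using 1
    simp only [Prod.smul_mk, Prod.mk_add_mk, map_add, map_smul, smul_apply,
      h.circleProj_comm, hwk, hwk', h.sq_apply]
    congr 1 <;> module

theorem pcomp_circleSum_self :
    pcomp (circleSum δ T Γ) (circleSum δ T Γ) = pcomp T T + pcomp δ δ :=
  LinearPMap.eq_of_eq_graph (Submodule.ext fun _ => h.mem_graph_pcomp_circleSum_iff)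

theorem circleSum_sub_horizontal_sub_vertical_domain :
    (circleSum δ T Γ - horizontal Γ (circleSum δ T Γ) - vertical 1 Γ δ).domain =
      (circleSum δ T Γ).domain := by
  ext x
  simp only [LinearPMap.sub_domain, Submodule.mem_inf, h.domain_horizontal_circleSum, and_self]
  refine ⟨And.left, fun hx => ⟨hx, ?_⟩⟩
  obtain ⟨z, hz⟩ := LinearPMap.mem_domain_iff.1 hx
  obtain ⟨w, y, hw, hy, rfl⟩ := mem_graph_circleSum.1 hz
  exact LinearPMap.mem_domain_iff.2 ⟨_, (mem_graph_vertical_one Γ δ _ _).2 ⟨w, hw, rfl⟩⟩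

theorem circleSum_sub_horizontal_sub_vertical_eq_zero {x y : H}
    (hxy : (x, y) ∈ (circleSum δ T Γ - horizontal Γ (circleSum δ T Γ) - vertical 1 Γ δ).graph) :
    y = 0 := by
  simp only [mem_graph_sub, mem_graph_vertical_one, h.mem_graph_horizontal_circleSum,
    mem_graph_circleSum] at hxy
  obtain ⟨_, _, ⟨_, v, ⟨w, u, hw, hu, rfl⟩, ⟨-, hv⟩, rfl⟩, ⟨w', hw', rfl⟩, rfl⟩ := hxy
  rw [T.mem_graph_snd_inj hu hv rfl, δ.mem_graph_snd_inj hw hw' rfl]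
  abel

/-- If `T` has compact resolvent on each `H_k`, then `Γ δ + T` has compact resolvent. -/
theorem hasCompactResolvent_circleSum
    (hT : ∀ k : ℤ, ∃ K E : H →L[ℂ] H, IsCompactOperator K ∧
      ∀ x y, x ∈ homogeneous δ k → (x, y) ∈ T.graph → x = K (y + E x)) :
    HasCompactResolvent (circleSum δ T Γ) := by
  obtain ⟨R, hR, hR'⟩ := exists_resolvent h.isSelfAdjoint_circleSum
  refine ⟨Complex.I, R, ?_, hR, hR'⟩
  have hfib : ∀ k x, (circleProj δ k (R x), circleProj δ k (x + Complex.I • R x) -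
      (k : ℂ) • Γ (circleProj δ k (R x))) ∈ T.graph := by
    intro k x
    have := hR x
    rw [h.graph_circleSum, mem_perturbedGraph] at this
    exact this k
  have hnorm : ∀ x, ‖x + Complex.I • R x‖ ≤ ‖x‖ := by
    intro x
    refine le_of_sq_le_sq ?_ (norm_nonneg _)
    have := norm_sq_sub_I_smul h.isSelfAdjoint_circleSum (hR x)
    rw [add_sub_cancel_right] at this
    rw [this]
    exact le_add_of_nonneg_right (sq_nonneg _)
  -- In each degree the component of `R x` is the compact `K` applied to a bounded operator of `x`.
  have hcompact : ∀ k, IsCompactOperator ((circleProj δ k).comp R) := by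
    intro k
    obtain ⟨K, E, hK, hKE⟩ := hT k
    let L : H →L[ℂ] H := (circleProj δ k).comp (1 + Complex.I • R) -
      (k : ℂ) • Γ.comp ((circleProj δ k).comp R) + E.comp ((circleProj δ k).comp R)
    have hL : ((circleProj δ k).comp R : H → H) = K ∘ L := by
      ext x
      exact hKE _ _ (circleProj_mem h.generator k (R x)) (hfib k x)
    rw [hL]
    exact hK.comp_clm L
  let F : ℕ → H →L[ℂ] H := fun n =>
    ∑ k ∈ Finset.Icc (-(n : ℤ)) n, (circleProj δ k).comp R
  have hF : ∀ n, IsCompactOperator (F n) := fun n =>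
    sum_mem (S := compactOperator (RingHom.id ℂ) H H) fun k _ => hcompact k
  -- Outside `[-n, n]` one has `n² ≤ k²`, and `norm_sq_add` bounds `k² ‖(R x)_k‖²` by the squared
  -- component of `(Γ δ + T) R x = x + i R x`. Hence `‖R - F n‖ ≤ 1 / n`, and `R` is a norm limit of
  -- compact operators.
  have hbound : ∀ n : ℕ, ∀ x, (n : ℝ) * ‖R x - F n x‖ ≤ ‖x‖ := by
    intro n x
    refine le_of_sq_le_sq ?_ (norm_nonneg _)
    rw [mul_pow]
    refine le_trans ?_ (pow_le_pow_left₀ (norm_nonneg _) (hnorm x) 2)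
    refine hasSum_le (fun k => ?_)
      ((hasSum_norm_sq_circleProj h.generator (R x - F n x)).mul_left ((n : ℝ) ^ 2))
      (hasSum_norm_sq_circleProj h.generator (x + Complex.I • R x))
    have hFn : circleProj δ k (F n x) =
        if k ∈ Finset.Icc (-(n : ℤ)) n then circleProj δ k (R x) else 0 := by
      simp only [F, sum_apply, ContinuousLinearMap.comp_apply, map_sum]
      rw [← Finset.sum_ite_eq (Finset.Icc (-(n : ℤ)) n) k fun l => circleProj δ l (R x)]
      refine Finset.sum_congr rfl fun l _ => ?_
      split_ifs with hl
      · rw [← hl, circleProj_circleProj_self h.generator]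
      · exact circleProj_circleProj_of_ne h.generator hl _
    rw [map_sub, hFn]
    split_ifs with hk
    · simp
    · rw [sub_zero]
      have h1 := h.norm_sq_add (hfib k x) k
      rw [sub_add_cancel] at h1
      rw [h1]
      refine le_add_of_nonneg_of_le (sq_nonneg _) (mul_le_mul_of_nonneg_right ?_ (sq_nonneg _))
      rw [sq_le_sq, Nat.abs_cast, ← Int.cast_abs]
      rw [Finset.mem_Icc, ← abs_le] at hk
      exact_mod_cast (not_le.1 hk).le
  refine isCompactOperator_of_tendsto (l := atTop) (F := F) ?_ (Eventually.of_forall hF)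
  rw [tendsto_iff_norm_sub_tendsto_zero]
  refine squeeze_zero' (Eventually.of_forall fun _ => norm_nonneg _) ?_
    tendsto_one_div_atTop_nhds_zero_nat
  filter_upwards [eventually_gt_atTop 0] with n hn
  refine ContinuousLinearMap.opNorm_le_bound _ (by positivity) fun x => ?_
  have hn' : (0 : ℝ) < n := by exact_mod_cast hn
  rw [sub_apply, norm_sub_rev, one_div, inv_mul_eq_div, le_div_iff₀' hn']
  exact hbound n x

end IsOddCircleOperator

end OddOperators

/-! ### Hopf–Galois extensions are strongly graded -/

section Bundle

variable {A : Type*} [Ring A] [Algebra ℂ A] (𝒜 : ℤ → Submodule ℂ A) [GradedAlgebra 𝒜]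

/-- The coefficient of `T ^ k`, as a linear map. -/
def laurentCoeff (k : ℤ) : ℂ[T;T⁻¹] →ₗ[ℂ] ℂ where
  toFun f := f.coeff k
  map_add' _ _ := rfl
  map_smul' _ _ := rfl

theorem laurentCoeff_T (k i : ℤ) :
    laurentCoeff k (LaurentPolynomial.T i) = if i = k then 1 else 0 :=
  LaurentPolynomial.T_apply k i

/-- The degree zero part of the `T ^ k` coefficient of an element of `A ⊗ ℂ[T;T⁻¹]`. -/
noncomputable def degreeZeroCoeff (k : ℤ) : A ⊗[ℂ] ℂ[T;T⁻¹] →ₗ[ℂ] A :=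
  GradedAlgebra.proj 𝒜 0 ∘ₗ (TensorProduct.rid ℂ A).toLinearMap ∘ₗ
    LinearMap.lTensor A (laurentCoeff k)

theorem degreeZeroCoeff_tmul_T (k i : ℤ) (a : A) :
    degreeZeroCoeff 𝒜 k (a ⊗ₜ[ℂ] (LaurentPolynomial.T i : ℂ[T;T⁻¹])) =
      if i = k then GradedAlgebra.proj 𝒜 0 a else 0 := by
  simp only [degreeZeroCoeff, LinearMap.comp_apply, LinearMap.lTensor_tmul,
    laurentCoeff_T, LinearEquiv.coe_coe, TensorProduct.rid_tmul]
  split_ifs <;> simp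

/-- On homogeneous `a' ⊗ a`, the coefficient of `T ^ k` selects `a ∈ 𝒜 k`, and the degree zero part
of `a' a` then selects `a' ∈ 𝒜 (-k)`. Applied to a preimage of `1 ⊗ T ^ k` under the canonical map,
this places `1` in `𝒜 (-k) * 𝒜 k`. -/
theorem degreeZeroCoeff_preCanonicalMap_mem (k : ℤ) (t : A ⊗[ℂ] A) :
    degreeZeroCoeff 𝒜 k (preCanonicalMap 𝒜 t) ∈ 𝒜 (-k) * 𝒜 k := by
  induction t using TensorProduct.induction_on with
  | zero => simp
  | add s t hs ht => rw [map_add, map_add]; exact add_mem hs ht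
  | tmul a' a =>
    induction a using DirectSum.Decomposition.inductionOn 𝒜 with
    | zero => simp
    | add m n hm hn => rw [TensorProduct.tmul_add, map_add, map_add]; exact add_mem hm hn
    | @homogeneous i m =>
      have h : preCanonicalMap 𝒜 (a' ⊗ₜ[ℂ] (m : A)) =
          (a' * m) ⊗ₜ[ℂ] (LaurentPolynomial.T i : ℂ[T;T⁻¹]) := by
        simp [preCanonicalMap, coaction_of_mem 𝒜 m.2]
      rw [h, degreeZeroCoeff_tmul_T]
      clear h
      split_ifs with hi
      · subst hi
        induction a' using DirectSum.Decomposition.inductionOn 𝒜 with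
        | zero => simp
        | add m n hm hn =>
          rw [add_mul, map_add]
          exact add_mem hm hn
        | @homogeneous j n =>
          have hmem : (n : A) * m ∈ 𝒜 (j + i) := SetLike.mul_mem_graded n.2 m.2
          rw [GradedAlgebra.proj_apply]
          by_cases hj : j = -i
          · subst hj
            rw [neg_add_cancel] at hmem
            rw [DirectSum.decompose_of_mem_same 𝒜 hmem]
            exact Submodule.mul_mem_mul n.2 m.2
          · rw [DirectSum.decompose_of_mem_ne 𝒜 hmem (fun e => hj (by omega))]
            exact zero_mem _
      · exact zero_mem _

/-- The grading of a Hopf-Galois extension is strong. -/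
theorem one_mem_mul_of_isHopfGalois (h : IsHopfGalois 𝒜) (k : ℤ) :
    (1 : A) ∈ 𝒜 (-k) * 𝒜 k := by
  obtain ⟨t, ht⟩ := h.2 ((1 : A) ⊗ₜ[ℂ] (LaurentPolynomial.T k : ℂ[T;T⁻¹]))
  obtain ⟨t, rfl⟩ := Submodule.mkQ_surjective _ t
  have h1 : preCanonicalMap 𝒜 t = (1 : A) ⊗ₜ[ℂ] (LaurentPolynomial.T k : ℂ[T;T⁻¹]) := ht
  have h2 := degreeZeroCoeff_preCanonicalMap_mem 𝒜 k t
  rw [h1, degreeZeroCoeff_tmul_T, if_pos rfl, GradedAlgebra.proj_apply,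
    DirectSum.decompose_of_mem_same 𝒜 SetLike.GradedOne.one_mem] at h2
  exact h2

end Bundle

/-! ### Conjugation by an antiunitary operator -/

section Antiunitary

variable {H : Type*} [NormedAddCommGroup H] [InnerProductSpace ℂ H]
  (J : H ≃ₗᵢ⋆[ℂ] H)

theorem conjBy_apply (S : H →L[ℂ] H) (x : H) : conjBy J S x = J (S (J.symm x)) := rfl

theorem conjBy_mul (S T : H →L[ℂ] H) : conjBy J (S * T) = conjBy J S * conjBy J T := by
  ext x
  simp [conjBy_apply]

theorem conjBy_one : conjBy J 1 = 1 := by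
  ext x
  simp [conjBy_apply]

theorem conjBy_add (S T : H →L[ℂ] H) : conjBy J (S + T) = conjBy J S + conjBy J T := by
  ext x
  simp [conjBy_apply]

theorem conjBy_sub (S T : H →L[ℂ] H) : conjBy J (S - T) = conjBy J S - conjBy J T := by
  ext x
  simp [conjBy_apply]

theorem conjBy_smul (c : ℂ) (S : H →L[ℂ] H) : conjBy J (c • S) = conj c • conjBy J S := by
  ext x
  simp [conjBy_apply, LinearIsometryEquiv.map_smulₛₗ]

theorem antiunitary_intCast_smul (k : ℤ) (x : H) : J ((k : ℂ) • x) = (k : ℂ) • J x := by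
  rw [LinearIsometryEquiv.map_smulₛₗ, map_intCast]

theorem inner_antiunitary (x y : H) : inner ℂ (J x) (J y) = inner ℂ y x := by
  rw [← inner_conj_symm y x, inner_eq_sum_norm_sq_div_four (𝕜 := ℂ) (J x) (J y),
    inner_eq_sum_norm_sq_div_four (𝕜 := ℂ) x y]
  have h1 : J x + J y = J (x + y) := (map_add J x y).symm
  have h2 : J x - J y = J (x - y) := (map_sub J x y).symm
  have h3 : J x - (RCLike.I : ℂ) • J y = J (x + (RCLike.I : ℂ) • y) := by
    rw [map_add, LinearIsometryEquiv.map_smulₛₗ]; simp [sub_eq_add_neg]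
  have h4 : J x + (RCLike.I : ℂ) • J y = J (x - (RCLike.I : ℂ) • y) := by
    rw [map_sub, LinearIsometryEquiv.map_smulₛₗ]; simp
  rw [h1, h2, h3, h4]
  simp only [LinearIsometryEquiv.norm_map]
  simp only [map_div₀, map_add, map_sub, map_mul, map_pow, RCLike.conj_ofReal, RCLike.conj_I,
    map_ofNat]
  ring

theorem star_conjBy [CompleteSpace H] (S : H →L[ℂ] H) : star (conjBy J S) = conjBy J (star S) := by
  rw [ContinuousLinearMap.star_eq_adjoint, ContinuousLinearMap.star_eq_adjoint]
  symm
  rw [ContinuousLinearMap.eq_adjoint_iff]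
  intro x y
  rw [conjBy_apply, conjBy_apply]
  conv_lhs => rw [← J.apply_symm_apply y]
  conv_rhs => rw [← J.apply_symm_apply x]
  rw [inner_antiunitary, inner_antiunitary, ContinuousLinearMap.adjoint_inner_right]

end Antiunitary

/-! ### Right actions of `A` and of one-forms, and their degrees -/

section RightActions

variable {A : Type*} [Ring A] [StarRing A] [Algebra ℂ A]
  {H : Type*} [NormedAddCommGroup H] [InnerProductSpace ℂ H] [CompleteSpace H]
  (π : A →⋆ₐ[ℂ] (H →L[ℂ] H)) (J : H ≃ₗᵢ⋆[ℂ] H)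

theorem rightMul_one : rightMul π J 1 = 1 := by
  simp [rightMul, conjBy_one]

theorem rightMul_add (a b : A) : rightMul π J (a + b) = rightMul π J a + rightMul π J b := by
  simp [rightMul, conjBy_add]

theorem rightMul_mul (a b : A) : rightMul π J (a * b) = rightMul π J b * rightMul π J a := by
  simp [rightMul, conjBy_mul]

theorem rightForm_sub (η θ : H →L[ℂ] H) :
    rightForm J (η - θ) = rightForm J η - rightForm J θ := by
  simp only [rightForm, map_sub, conjBy_sub]
  abel

theorem rightForm_smul (c : ℂ) (η : H →L[ℂ] H) : rightForm J (c • η) = c • rightForm J η := by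
  simp only [rightForm, map_smulₛₗ, conjBy_smul, smul_neg]
  simp

theorem rightForm_rep_mul (p : A) (η : H →L[ℂ] H) :
    rightForm J (π p * η) = rightForm J η * rightMul π J p := by
  simp only [rightForm, rightMul, ← ContinuousLinearMap.star_eq_adjoint, star_mul, conjBy_mul,
    map_star, neg_mul]

theorem isSelfAdjoint_rightForm {η : H →L[ℂ] H} (hη : IsSelfAdjoint η) :
    IsSelfAdjoint (rightForm J η) := by
  rw [isSelfAdjoint_iff, rightForm, star_neg, star_conjBy, ← ContinuousLinearMap.star_eq_adjoint,
    hη.star_eq, hη.star_eq]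

variable {π J} {D : H →ₗ.[ℂ] H}

theorem IsRealStructure.symm_apply (hJ : IsRealStructure π D J) (x : H) : J.symm x = -(J x) := by
  rw [LinearIsometryEquiv.symm_apply_eq, map_neg, hJ.sq, neg_neg]

theorem IsRealStructure.symm_mem (hJ : IsRealStructure π D J) {x y : H}
    (h : (x, y) ∈ D.graph) : (J.symm x, J.symm y) ∈ D.graph := by
  rw [hJ.symm_apply, hJ.symm_apply]
  exact neg_mem (hJ.comm _ h)

/-- The commutator of `D` with the right action of `p` is the right action of `[D, p]`. -/
theorem IsRealStructure.isBoundedCommutator_rightMul (hJ : IsRealStructure π D J)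
    (hD : IsSelfAdjoint D) {p : A} {C : H →L[ℂ] H} (hC : IsBoundedCommutator D (π p) C) :
    IsBoundedCommutator D (rightMul π J p) (rightForm J C) := by
  rintro ⟨x, y⟩ hxy
  have h1 := hJ.comm _ (hC.adjoint hD _ (hJ.symm_mem hxy))
  rw [← map_star] at h1
  simpa [rightMul, rightForm, conjBy_apply, ContinuousLinearMap.star_eq_adjoint] using h1

theorem IsRealStructure.conjBy_conjBy (hJ : IsRealStructure π D J) (S : H →L[ℂ] H) :
    conjBy J (conjBy J S) = S := by
  ext x
  simp [conjBy_apply, hJ.symm_apply, hJ.sq]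

variable {𝒜 : ℤ → Submodule ℂ A} [GradedAlgebra 𝒜] {δ : H →ₗ.[ℂ] H}

theorem IsEquivariant.isBoundedCommutator_rep (hδ : IsEquivariant 𝒜 π D J δ) {j : ℤ} {a : A}
    (ha : a ∈ 𝒜 j) : IsBoundedCommutator δ (π a) ((j : ℂ) • π a) := by
  have := hδ.rep a
  rwa [circleDeriv_of_mem 𝒜 ha, map_smul] at this

theorem IsEquivariant.circleProj_rep (hδ : IsEquivariant 𝒜 π D J δ) {j : ℤ} {a : A}
    (ha : a ∈ 𝒜 j) (k : ℤ) (x : H) :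
    circleProj δ (k + j) (π a x) = π a (circleProj δ k x) :=
  circleProj_apply_of_isBoundedCommutator hδ.generator (hδ.isBoundedCommutator_rep ha) k x

theorem IsEquivariant.circleProj_real (hδ : IsEquivariant 𝒜 π D J δ) (k : ℤ) (x : H) :
    circleProj δ (-k) (J x) = J (circleProj δ k x) := by
  refine circleProj_map_of_mem hδ.generator (f := (J : H →+ H)) J.continuous
    (σ := fun k => -k) neg_injective (fun k x hx => ?_) k x
  have := hδ.real _ hx
  simpa [mem_homogeneous, antiunitary_intCast_smul] using this

theorem IsEquivariant.rightMul_mem (hδ : IsEquivariant 𝒜 π D J δ) (hJ : IsRealStructure π D J)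
    (hstar : ∀ (k : ℤ) (a : A), a ∈ 𝒜 k → star a ∈ 𝒜 (-k)) {j k : ℤ} {a : A} (ha : a ∈ 𝒜 j)
    {x : H} (hx : x ∈ homogeneous δ k) : rightMul π J a x ∈ homogeneous δ (k + j) := by
  have h1 := hδ.real _ hx
  have h2 := hδ.isBoundedCommutator_rep (hstar j a ha) _ h1
  have h3 := neg_mem (hδ.real _ h2)
  rw [mem_homogeneous]
  convert h3 using 1
  simp [rightMul, conjBy_apply, hJ.symm_apply, add_smul, antiunitary_intCast_smul, add_comm]

/-- Commutators with homogeneous elements are homogeneous. -/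
theorem IsEquivariant.circleProj_commutator (hδ : IsEquivariant 𝒜 π D J δ)
    (hD : IsSelfAdjoint D) {j : ℤ} {a : A} (ha : a ∈ 𝒜 j) {C : H →L[ℂ] H}
    (hC : IsBoundedCommutator D (π a) C) (k : ℤ) (x : H) :
    circleProj δ (k + j) (C x) = C (circleProj δ k x) := by
  -- Both sides are continuous, so it suffices to compare them on the dense domain of `D`, where `C`
  -- really is a commutator.
  have h : (fun x => circleProj δ (k + j) (C x)) = fun x => C (circleProj δ k x) := by
    refine Continuous.ext_on hD.dense_domain (by fun_prop) (by fun_prop) fun x hx => ?_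
    obtain ⟨y, hy⟩ := LinearPMap.mem_domain_iff.1 hx
    have h1 := hδ.dirac.circleProj_mem (k + j) (hC _ hy)
    have h2 := hC _ (hδ.dirac.circleProj_mem k hy)
    simp only [map_add, hδ.circleProj_rep ha] at h1
    exact add_left_cancel (D.mem_graph_snd_inj h1 h2 rfl)
  exact congrFun h x

theorem IsRealStructure.commute_conjBy_rep (hJ : IsRealStructure π D J) (a b : A) :
    Commute (π a) (conjBy J (π b)) := by
  simpa using hJ.order_zero a (star b)

/-- The order one condition conjugated by `J`; since `J² = -1`, conjugating twice is the identity.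
-/
theorem IsRealStructure.commute_rep_conjBy_commutator (hJ : IsRealStructure π D J) (a : A)
    {q : A} {C : H →L[ℂ] H} (hC : IsBoundedCommutator D (π q) C) :
    Commute (π a) (conjBy J C) := by
  have h := hJ.order_one q (star a) C hC
  rw [star_star] at h
  have h2 := congrArg (conjBy J) h.eq
  rw [conjBy_mul, conjBy_mul, hJ.conjBy_conjBy] at h2
  exact h2.symm

end RightActions

/-! ### The remainder `Z` and the anticommutator of `Γ` with one-forms -/

section Remainder

variable {A : Type*} [Ring A] [StarRing A] [Algebra ℂ A]
  {H : Type*} [NormedAddCommGroup H] [InnerProductSpace ℂ H] [CompleteSpace H]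
  {𝒜 : ℤ → Submodule ℂ A} [GradedAlgebra 𝒜] {π : A →⋆ₐ[ℂ] (H →L[ℂ] H)} {D : H →ₗ.[ℂ] H}
  {J : H ≃ₗᵢ⋆[ℂ] H} {δ : H →ₗ.[ℂ] H} {Γ Z : H →L[ℂ] H}

theorem IsProjectable.sq_apply (hΓ : IsProjectable π D J δ Γ) (x : H) : Γ (Γ x) = x := by
  simpa using congrArg (fun S : H →L[ℂ] H => S x) hΓ.sq

theorem IsProjectable.mem_graph_delta (hΓ : IsProjectable π D J δ Γ) {x w : H}
    (hw : (x, w) ∈ δ.graph) : (Γ x, Γ w) ∈ δ.graph := by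
  simpa using hΓ.comm_circle _ hw

theorem IsProjectable.exists_mem_graph (hΓ : IsProjectable π D J δ Γ) {x y : H}
    (h : (x, y) ∈ D.graph) : ∃ y', (Γ x, y') ∈ D.graph :=
  LinearPMap.mem_domain_iff.1 (hΓ.domain x (LinearPMap.mem_domain_iff.2 ⟨y, h⟩))

/-- As `Γ² = 1`, `D - D_h = ½ (D + Γ D Γ)`. This formula yields the symmetries of `Z`:
selfadjointness and commutation with `Γ` and with the circle. -/
theorem IsFibreRemainder.apply_eq (hZ : IsFibreRemainder π D J δ Γ 1 Z)
    (hΓ : IsProjectable π D J δ Γ) {x y y' w : H} (hy : (x, y) ∈ D.graph)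
    (hy' : (Γ x, y') ∈ D.graph) (hw : (x, w) ∈ δ.graph) :
    Z x = (1 / 2 : ℂ) • (y + Γ y') - Γ w := by
  have h : (x, y - (1 / 2 : ℂ) • Γ (Γ y - y') - Γ w) ∈
      (D - horizontal Γ D - vertical 1 Γ δ).graph :=
    (mem_graph_sub _ _ _ _).2 ⟨_, _, (mem_graph_sub _ _ _ _).2 ⟨_, _, hy,
      (mem_graph_horizontal _ _ _ _).2 ⟨y, y', hy, hy', rfl⟩, rfl⟩,
      (mem_graph_vertical_one _ _ _ _).2 ⟨w, hw, rfl⟩, rfl⟩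
  rw [hZ.eq _ h]
  simp only [map_sub, hΓ.sq_apply]
  module

theorem IsFibreRemainder.dense_inf (hZ : IsFibreRemainder π D J δ Γ 1 Z) :
    Dense ((D.domain ⊓ δ.domain : Submodule ℂ H) : Set H) := by
  refine hZ.dense.mono fun x hx => ?_
  obtain ⟨_, hz⟩ := LinearPMap.mem_domain_iff.1 hx
  simp only [mem_graph_sub, mem_graph_vertical_one] at hz
  obtain ⟨_, _, ⟨y, _, hy, -, -⟩, ⟨w, hw, -⟩, -⟩ := hz
  exact ⟨LinearPMap.mem_domain_iff.2 ⟨_, hy⟩, LinearPMap.mem_domain_iff.2 ⟨_, hw⟩⟩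

/-- Continuous maps agree if they agree on the common domain of `D` and `δ`. -/
theorem IsFibreRemainder.ext (hZ : IsFibreRemainder π D J δ Γ 1 Z)
    (hΓ : IsProjectable π D J δ Γ) {E : Type*} [TopologicalSpace E] [T2Space E] {f g : H → E}
    (hf : Continuous f) (hg : Continuous g)
    (h : ∀ x y y' w, (x, y) ∈ D.graph → (Γ x, y') ∈ D.graph → (x, w) ∈ δ.graph → f x = g x)
    (x : H) : f x = g x := by
  refine congrFun (Continuous.ext_on hZ.dense_inf hf hg ?_) x
  rintro u ⟨hu, hu'⟩
  obtain ⟨y, hy⟩ := LinearPMap.mem_domain_iff.1 hu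
  obtain ⟨w, hw⟩ := LinearPMap.mem_domain_iff.1 hu'
  obtain ⟨y', hy'⟩ := hΓ.exists_mem_graph hy
  exact h u y y' w hy hy' hw

theorem IsFibreRemainder.commute_symmetry (hZ : IsFibreRemainder π D J δ Γ 1 Z)
    (hΓ : IsProjectable π D J δ Γ) (x : H) : Z (Γ x) = Γ (Z x) := by
  refine hZ.ext hΓ (f := fun x => Z (Γ x)) (g := fun x => Γ (Z x))
    (by fun_prop) (by fun_prop) (fun x y y' w hy hy' hw => ?_) x
  rw [hZ.apply_eq hΓ hy hy' hw, hZ.apply_eq hΓ hy' (by rwa [hΓ.sq_apply])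
    (hΓ.mem_graph_delta hw)]
  simp only [map_sub, map_add, map_smul, hΓ.sq_apply]
  rw [add_comm]

theorem IsFibreRemainder.circleProj_comm (hZ : IsFibreRemainder π D J δ Γ 1 Z)
    (hΓ : IsProjectable π D J δ Γ) (hδ : IsEquivariant 𝒜 π D J δ) (k : ℤ) (x : H) :
    circleProj δ k (Z x) = Z (circleProj δ k x) := by
  have hΓP := commute_circleProj_of_isBoundedCommutator hδ.generator hΓ.comm_circle
  refine hZ.ext hΓ (f := fun x => circleProj δ k (Z x)) (g := fun x => Z (circleProj δ k x))
    (by fun_prop) (by fun_prop) (fun x y y' w hy hy' hw => ?_) x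
  have hw' : (circleProj δ k x, circleProj δ k w) ∈ δ.graph := by
    rw [(mem_graph_iff_circleProj hδ.generator x w).1 hw k]
    exact circleProj_mem hδ.generator k x
  have hy'' := hδ.dirac.circleProj_mem k hy'
  rw [hΓP] at hy''
  rw [hZ.apply_eq hΓ hy hy' hw, hZ.apply_eq hΓ (hδ.dirac.circleProj_mem k hy) hy'' hw']
  simp only [map_sub, map_add, map_smul, hΓP]

theorem IsFibreRemainder.isSelfAdjoint (hZ : IsFibreRemainder π D J δ Γ 1 Z)
    (hΓ : IsProjectable π D J δ Γ) (hD : IsSelfAdjoint D) (hδ : IsSelfAdjoint δ) :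
    IsSelfAdjoint Z := by
  have hsym := inner_comm_of_isSelfAdjoint hΓ.selfAdjoint
  rw [ContinuousLinearMap.isSelfAdjoint_iff_isSymmetric]
  intro x u
  refine hZ.ext hΓ (f := fun x => inner ℂ (Z x) u) (g := fun x => inner ℂ x (Z u))
    (by fun_prop) (by fun_prop) (fun x y y' w hy hy' hw => ?_) x
  refine hZ.ext hΓ (f := fun u => inner ℂ (Z x) u) (g := fun u => inner ℂ x (Z u))
    (by fun_prop) (by fun_prop) (fun u v v' t hv hv' ht => ?_) u
  rw [hZ.apply_eq hΓ hy hy' hw, hZ.apply_eq hΓ hv hv' ht]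
  have h1 := inner_graph_comm hD hy hv
  have h2 := inner_graph_comm hD hy' hv'
  have h3 := inner_graph_comm hδ hw (hΓ.mem_graph_delta ht)
  simp only [inner_sub_left, inner_sub_right, inner_add_left, inner_add_right, inner_smul_left,
    inner_smul_right, hsym, h1, h3]
  rw [← hsym x v', h2, map_div₀, map_one, map_ofNat]

/-- Commute `q` with `Z = ½ (D + Γ D Γ) - Γ δ`: since `Z` and `Γ` commute with `q`, `0 = ½ ([D, q] +
Γ [D, q] Γ) - Γ δ(q)`. Multiply by `2 Γ`. -/
theorem IsFibreRemainder.symmetry_commutator (hZ : IsFibreRemainder π D J δ Γ 1 Z)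
    (hΓ : IsProjectable π D J δ Γ) (hδ : IsEquivariant 𝒜 π D J δ)
    (hZA : ∀ a : A, Commute Z (π a)) {q : A} {C : H →L[ℂ] H}
    (hC : IsBoundedCommutator D (π q) C) (x : H) :
    Γ (C x) + C (Γ x) = (2 : ℂ) • π (circleDeriv 𝒜 q) x := by
  have hΓπ : ∀ (a : A) (u : H), Γ (π a u) = π a (Γ u) := fun a u =>
    congrArg (fun S : H →L[ℂ] H => S u) (hΓ.comm_rep a).eq
  have hZπ : ∀ (a : A) (u : H), Z (π a u) = π a (Z u) := fun a u =>
    congrArg (fun S : H →L[ℂ] H => S u) (hZA a).eq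
  refine hZ.ext hΓ (f := fun x => Γ (C x) + C (Γ x)) (g := fun x => (2 : ℂ) • π (circleDeriv 𝒜 q) x)
    (by fun_prop) (by fun_prop) (fun x y y' w hy hy' hw => ?_) x
  have h1 := hC _ hy
  have h2 := hC _ hy'
  rw [← hΓπ] at h2
  have h3 := hZ.apply_eq hΓ h1 h2 (hδ.rep q (x, w) hw)
  rw [hZπ, hZ.apply_eq hΓ hy hy' hw] at h3
  have h4 := congrArg Γ h3
  simp only [map_sub, map_add, map_smul, hΓ.sq_apply, hΓπ] at h4
  linear_combination (norm := module) (-2 : ℂ) • h4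

/-- One-forms are finite sums `∑ pᵢ [D, qᵢ]`. -/
theorem exists_eq_sum_of_mem_oneForms {η : H →L[ℂ] H} (hη : η ∈ oneForms π D ⊤) :
    ∃ (n : ℕ) (p q : Fin n → A) (C : Fin n → H →L[ℂ] H),
      (∀ i, IsBoundedCommutator D (π (q i)) (C i)) ∧ η = ∑ i, π (p i) * C i := by
  induction hη using Submodule.span_induction with
  | mem η h =>
    obtain ⟨p, -, q, -, C, hC, rfl⟩ := h
    exact ⟨1, fun _ => p, fun _ => q, fun _ => C, fun _ => hC, by simp⟩
  | zero => exact ⟨0, Fin.elim0, Fin.elim0, Fin.elim0, fun i => i.elim0, by simp⟩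
  | add η θ _ _ h h' =>
    obtain ⟨n, p, q, C, hC, rfl⟩ := h
    obtain ⟨m, p', q', C', hC', rfl⟩ := h'
    refine ⟨n + m, Fin.append p p', Fin.append q q', Fin.append C C', fun i => ?_, ?_⟩
    · refine Fin.addCases (fun i => ?_) (fun i => ?_) i
      · simpa using hC i
      · simpa using hC' i
    · simp [Fin.sum_univ_add]
  | smul c η _ h =>
    obtain ⟨n, p, q, C, hC, rfl⟩ := h
    exact ⟨n, fun i => c • p i, q, C, hC, by simp [Finset.smul_sum]⟩

variable {ω : H →L[ℂ] H}

/-- Apply the preceding identity termwise to `ω = ∑ pᵢ [D, qᵢ]`; the sum becomes `2 ∑ pᵢ δ(qᵢ) = 2`.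
-/
theorem IsStrongConnection.symmetry_anticomm (hω : IsStrongConnection 𝒜 π D δ ω)
    (hZ : IsFibreRemainder π D J δ Γ 1 Z) (hΓ : IsProjectable π D J δ Γ)
    (hδ : IsEquivariant 𝒜 π D J δ) (hZA : ∀ a : A, Commute Z (π a)) (x : H) :
    Γ (ω x) + ω (Γ x) = (2 : ℂ) • x := by
  have hΓπ : ∀ (a : A) (u : H), Γ (π a u) = π a (Γ u) := fun a u =>
    congrArg (fun S : H →L[ℂ] H => S u) (hΓ.comm_rep a).eq
  obtain ⟨n, p, q, C, hC, h⟩ := exists_eq_sum_of_mem_oneForms hω.mem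
  have h1 := congrArg (fun S : H →L[ℂ] H => S x) (hω.vertical n p q C hC h)
  simp only [sum_apply, one_apply_eq_self, map_mul, mul_apply_eq_comp] at h1
  rw [h]
  simp only [sum_apply, mul_apply_eq_comp, map_sum, hΓπ]
  conv_rhs => rw [← h1, Finset.smul_sum]
  rw [← Finset.sum_add_distrib]
  refine Finset.sum_congr rfl fun i _ => ?_
  rw [← map_add, hZ.symmetry_commutator hΓ hδ hZA (hC i), map_smul]

theorem rightForm_apply_of_isSelfAdjoint (hω_sa : IsSelfAdjoint ω) (x : H) :
    rightForm J ω x = -(J (ω (J.symm x))) := by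
  rw [rightForm, ← ContinuousLinearMap.star_eq_adjoint, hω_sa.star_eq]
  rfl

/-- The sign in `h ω = -J ω J⁻¹ h` cancels the one from `Γ J = -J Γ`, so the constant is again `+2`.
-/
theorem IsStrongConnection.symmetry_rightForm (hω : IsStrongConnection 𝒜 π D δ ω)
    (hω_sa : IsSelfAdjoint ω) (hJ : IsRealStructure π D J)
    (hZ : IsFibreRemainder π D J δ Γ 1 Z) (hΓ : IsProjectable π D J δ Γ)
    (hδ : IsEquivariant 𝒜 π D J δ) (hZA : ∀ a : A, Commute Z (π a)) (x : H) :
    Γ (rightForm J ω x) + rightForm J ω (Γ x) = (2 : ℂ) • x := by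
  have h := hω.symmetry_anticomm hZ hΓ hδ hZA (J.symm x)
  have h1 : J.symm (Γ x) = -(Γ (J.symm x)) := by
    rw [hJ.symm_apply, hJ.symm_apply, map_neg, hΓ.anticomm_real]
    simp
  rw [rightForm_apply_of_isSelfAdjoint hω_sa, rightForm_apply_of_isSelfAdjoint hω_sa, h1, map_neg,
    hΓ.anticomm_real, neg_neg, map_neg, map_neg, neg_neg, ← map_add, h,
    LinearIsometryEquiv.map_smulₛₗ, map_ofNat, J.apply_symm_apply]

theorem IsStrongConnection.circleProj_rightForm (hω : IsStrongConnection 𝒜 π D δ ω)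
    (hω_sa : IsSelfAdjoint ω) (hJ : IsRealStructure π D J)
    (hδ : IsEquivariant 𝒜 π D J δ) (k : ℤ) (x : H) :
    circleProj δ k (rightForm J ω x) = rightForm J ω (circleProj δ k x) := by
  have h := fun y => hδ.circleProj_real (-k) y
  rw [neg_neg] at h
  have h2 := hδ.circleProj_real k x
  rw [rightForm_apply_of_isSelfAdjoint hω_sa, rightForm_apply_of_isSelfAdjoint hω_sa, map_neg, h,
    commute_circleProj_of_isBoundedCommutator hδ.generator hω.invariant, hJ.symm_apply,
    hJ.symm_apply, map_neg, h2]

/-- The order zero and order one conditions handle the factors `pᵢ` and `[D, qᵢ]` of `ω` separately.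
-/
theorem IsStrongConnection.rightForm_rep (hω : IsStrongConnection 𝒜 π D δ ω)
    (hω_sa : IsSelfAdjoint ω) (hJ : IsRealStructure π D J) (a : A) (x : H) :
    rightForm J ω (π a x) = π a (rightForm J ω x) := by
  have h : Commute (π a) (rightForm J ω) := by
    rw [rightForm, ← ContinuousLinearMap.star_eq_adjoint, hω_sa.star_eq]
    refine Commute.neg_right ?_
    obtain ⟨n, p, q, C, hC, rfl⟩ := exists_eq_sum_of_mem_oneForms hω.mem
    have h1 : conjBy J (∑ i, π (p i) * C i) = ∑ i, conjBy J (π (p i)) * conjBy J (C i) := by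
      ext x
      simp [conjBy_apply]
    rw [h1]
    exact Commute.sum_right _ _ _ fun i _ => (hJ.commute_conjBy_rep a (p i)).mul_right
      (hJ.commute_rep_conjBy_commutator a (hC i))
  exact congrArg (fun S : H →L[ℂ] H => S x) h.eq.symm

end Remainder

/-! ### Fibrewise form of `D_ω` and the properties of the full twisted operator -/

section Twisted

variable {A : Type*} [Ring A] [StarRing A] [Algebra ℂ A]
  {H : Type*} [NormedAddCommGroup H] [InnerProductSpace ℂ H] [CompleteSpace H]
  {𝒜 : ℤ → Submodule ℂ A} [GradedAlgebra 𝒜] {π : A →⋆ₐ[ℂ] (H →L[ℂ] H)} {D : H →ₗ.[ℂ] H}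
  {J : H ≃ₗᵢ⋆[ℂ] H} {δ : H →ₗ.[ℂ] H} {Γ Z ω : H →L[ℂ] H}

/-- The operator `-Z - k (· ω)` by which `D_ω` differs from `D` on `H_k`. -/
noncomputable def twistPerturbation (J : H ≃ₗᵢ⋆[ℂ] H) (Z ω : H →L[ℂ] H) (k : ℤ) : H →L[ℂ] H :=
  -Z - (k : ℂ) • rightForm J ω

theorem isFibrePerturbation_twist (hD : IsSelfAdjoint D) (hJ : IsRealStructure π D J)
    (hδ : IsEquivariant 𝒜 π D J δ) (hΓ : IsProjectable π D J δ Γ)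
    (hZ : IsFibreRemainder π D J δ Γ 1 Z) (hω : IsStrongConnection 𝒜 π D δ ω)
    (hω_sa : IsSelfAdjoint ω) : IsFibrePerturbation δ D (twistPerturbation J Z ω) where
  generator := hδ.generator
  selfAdjoint_op := hD
  comm_op := hδ.dirac
  selfAdjoint k := by
    have h1 := (hZ.isSelfAdjoint hΓ hD hδ.generator.selfAdjoint).star_eq
    have h2 := (isSelfAdjoint_rightForm J hω_sa).star_eq
    rw [isSelfAdjoint_iff, twistPerturbation, star_sub, star_neg, star_smul, h1, h2]
    simp
  comm k l x := by
    simp only [twistPerturbation, sub_apply, neg_apply, smul_apply, map_sub, map_neg, map_smul,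
      hZ.circleProj_comm hΓ hδ, hω.circleProj_rightForm hω_sa hJ hδ]

/-- On `H_k`, the operator `D - Z - k (· ω)` anticommutes with `Γ`. -/
theorem symmetry_mem_graph_twist (hJ : IsRealStructure π D J)
    (hδ : IsEquivariant 𝒜 π D J δ) (hΓ : IsProjectable π D J δ Γ)
    (hZ : IsFibreRemainder π D J δ Γ 1 Z) (hω : IsStrongConnection 𝒜 π D δ ω)
    (hω_sa : IsSelfAdjoint ω) (hZA : ∀ a : A, Commute Z (π a)) {k : ℤ} {x y : H}
    (hx : x ∈ homogeneous δ k) (hxy : (x, y - twistPerturbation J Z ω k x) ∈ D.graph) :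
    (Γ x, -(Γ y) - twistPerturbation J Z ω k (Γ x)) ∈ D.graph := by
  obtain ⟨y', hy'⟩ := hΓ.exists_mem_graph hxy
  have h1 := hZ.apply_eq hΓ hxy hy' hx
  -- The formula for `Z` contributes `2k` through `δ x = k x`, and the anticommutator of `Γ` with `·
  -- ω` cancels it.
  have h2 : -(Γ y) - twistPerturbation J Z ω k (Γ x) = y' := by
    have h3 := congrArg Γ h1
    have h4 := hω.symmetry_rightForm hω_sa hJ hZ hΓ hδ hZA x
    simp only [LinearMap.smul_apply, LinearMap.id_apply, twistPerturbation, sub_apply, neg_apply,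
      smul_apply, map_sub, map_neg, map_smul, map_add, hΓ.sq_apply, hZ.commute_symmetry hΓ]
      at h3 ⊢
    linear_combination (norm := module) (2 : ℂ) • h3 + (k : ℂ) • h4
  rwa [h2]

theorem isOddCircleOperator_twist (hD : IsSelfAdjoint D) (hJ : IsRealStructure π D J)
    (hδ : IsEquivariant 𝒜 π D J δ) (hΓ : IsProjectable π D J δ Γ)
    (hZ : IsFibreRemainder π D J δ Γ 1 Z) (hω : IsStrongConnection 𝒜 π D δ ω)
    (hω_sa : IsSelfAdjoint ω) (hZA : ∀ a : A, Commute Z (π a)) {T : H →ₗ.[ℂ] H}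
    (hT : T.graph = perturbedGraph δ D (twistPerturbation J Z ω)) :
    IsOddCircleOperator δ T Γ where
  generator := hδ.generator
  selfAdjoint_op := (isFibrePerturbation_twist hD hJ hδ hΓ hZ hω hω_sa).isSelfAdjoint hT
  comm_op := (isFibrePerturbation_twist hD hJ hδ hΓ hZ hω hω_sa).commutesWithCircle hT
  selfAdjoint := hΓ.selfAdjoint
  sq := hΓ.sq
  comm_circle := hΓ.comm_circle
  anticomm := by
    rintro ⟨x, y⟩ hxy
    rw [hT, mem_perturbedGraph] at hxy ⊢
    intro k
    have hΓP := commute_circleProj_of_isBoundedCommutator hδ.generator hΓ.comm_circle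
    rw [map_neg, hΓP, hΓP]
    exact symmetry_mem_graph_twist hJ hδ hΓ hZ hω hω_sa hZA (circleProj_mem hδ.generator k x)
      (hxy k)

theorem generator_mem_perturbedGraph (hD : IsSelfAdjoint D) (hJ : IsRealStructure π D J)
    (hδ : IsEquivariant 𝒜 π D J δ) (hΓ : IsProjectable π D J δ Γ)
    (hstar : ∀ (k : ℤ) (a : A), a ∈ 𝒜 k → star a ∈ 𝒜 (-k))
    (hZ : IsFibreRemainder π D J δ Γ 1 Z) (hω : IsStrongConnection 𝒜 π D δ ω)
    (hω_sa : IsSelfAdjoint ω) {k : ℤ} {p : A} (hp : p ∈ 𝒜 k) {C : H →L[ℂ] H}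
    (hC : IsBoundedCommutator D (π p) C) {h y : H} (hh : h ∈ homogeneous δ 0)
    (hy : (h, y) ∈ (horizontal Γ D).graph) :
    (rightMul π J p h, rightMul π J p y + rightForm J (C - (k : ℂ) • (π p * ω)) h) ∈
      perturbedGraph δ D (twistPerturbation J Z ω) := by
  obtain ⟨y₁, y', hy₁, hy', rfl⟩ := (mem_graph_horizontal _ _ _ _).1 hy
  have h1 := hZ.apply_eq hΓ hy₁ hy' hh
  -- Since `δ h = 0`, the vertical term drops out and `D_h h = D h - Z h`.
  have h2 : (1 / 2 : ℂ) • Γ (Γ y₁ - y') = y₁ - Z h := by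
    rw [h1]
    simp only [LinearMap.smul_apply, LinearMap.id_apply, map_smul, map_sub, hΓ.sq_apply]
    push_cast
    module
  have hmem := hδ.rightMul_mem hJ hstar hp hh
  rw [zero_add] at hmem
  refine (isFibrePerturbation_twist hD hJ hδ hΓ hZ hω hω_sa).mem_of_homogeneous hmem ?_
  have h3 := hJ.isBoundedCommutator_rightMul hD hC _ hy₁
  have h4 : Z (rightMul π J p h) = rightMul π J p (Z h) :=
    congrArg (fun S : H →L[ℂ] H => S h) (hZ.comm p).eq
  convert h3 using 2
  rw [h2, rightForm_sub, rightForm_smul, rightForm_rep_mul]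
  simp only [twistPerturbation, sub_apply, neg_apply, smul_apply, mul_apply_eq_comp, map_sub, h4]
  abel

/-- For `t = a b` one has `x t = (x a) b` with `x a ∈ H_0`. Only membership in the domain of
`D_ω^{(k)}` is asserted: for `t = 1` the value `z` is forced afterwards, because the larger relation
is single-valued. -/
theorem mem_span_generators (hD : IsSpectralTriple π D) (hJ : IsRealStructure π D J)
    (hδ : IsEquivariant 𝒜 π D J δ) (hΓ : IsProjectable π D J δ Γ)
    (hstar : ∀ (k : ℤ) (a : A), a ∈ 𝒜 k → star a ∈ 𝒜 (-k)) {k : ℤ} {x y : H}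
    (hx : x ∈ homogeneous δ k) (hxy : (x, y) ∈ D.graph) {t : A} (ht : t ∈ 𝒜 (-k) * 𝒜 k) :
    ∃ z, (rightMul π J t x, z) ∈ twistedGraph 𝒜 π D J δ Γ ω k := by
  induction ht using Submodule.mul_induction_on' with
  | add a _ b _ ha hb =>
    obtain ⟨z, hz⟩ := ha
    obtain ⟨z', hz'⟩ := hb
    refine ⟨z + z', ?_⟩
    rw [rightMul_add]
    exact add_mem hz hz'
  | mem_mul_mem a ha b hb =>
    obtain ⟨C, hC⟩ := hD.bounded_commutator a
    obtain ⟨C', hC'⟩ := hD.bounded_commutator b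
    have h1 := hδ.rightMul_mem hJ hstar ha hx
    rw [add_neg_cancel] at h1
    have h2 := hJ.isBoundedCommutator_rightMul hD.selfAdjoint hC _ hxy
    obtain ⟨y', hy'⟩ := hΓ.exists_mem_graph h2
    rw [rightMul_mul]
    exact ⟨_, Submodule.le_topologicalClosure _ (Submodule.subset_span
      ⟨b, hb, C', hC', rightMul π J a x, h1, _,
        (mem_graph_horizontal _ _ _ _).2 ⟨_, y', h2, hy', rfl⟩, rfl⟩)⟩

theorem twistedGraph_le (hD : IsSelfAdjoint D) (hJ : IsRealStructure π D J)
    (hδ : IsEquivariant 𝒜 π D J δ) (hΓ : IsProjectable π D J δ Γ)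
    (hstar : ∀ (k : ℤ) (a : A), a ∈ 𝒜 k → star a ∈ 𝒜 (-k))
    (hZ : IsFibreRemainder π D J δ Γ 1 Z) (hω : IsStrongConnection 𝒜 π D δ ω)
    (hω_sa : IsSelfAdjoint ω) (k : ℤ) :
    twistedGraph 𝒜 π D J δ Γ ω k ≤ perturbedGraph δ D (twistPerturbation J Z ω) := by
  refine Submodule.topologicalClosure_minimal _ (Submodule.span_le.2 ?_)
    (isFibrePerturbation_twist hD hJ hδ hΓ hZ hω hω_sa).isClosed
  rintro _ ⟨p, hp, C, hC, h, hh, y, hy, rfl⟩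
  exact generator_mem_perturbedGraph hD hJ hδ hΓ hstar hZ hω hω_sa hp hC hh hy

/-- `D_ω` is the direct sum of the operators `D - Z - k (· ω)` on the spaces `H_k`. -/
theorem twistedDiracGraph_eq (hHG : IsHopfGalois 𝒜) (hD : IsSpectralTriple π D)
    (hJ : IsRealStructure π D J) (hδ : IsEquivariant 𝒜 π D J δ) (hΓ : IsProjectable π D J δ Γ)
    (hstar : ∀ (k : ℤ) (a : A), a ∈ 𝒜 k → star a ∈ 𝒜 (-k))
    (hZ : IsFibreRemainder π D J δ Γ 1 Z) (hω : IsStrongConnection 𝒜 π D δ ω)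
    (hω_sa : IsSelfAdjoint ω) :
    twistedDiracGraph 𝒜 π D J δ Γ ω = perturbedGraph δ D (twistPerturbation J Z ω) := by
  have hB := isFibrePerturbation_twist hD.selfAdjoint hJ hδ hΓ hZ hω hω_sa
  have hle := twistedGraph_le hD.selfAdjoint hJ hδ hΓ hstar hZ hω hω_sa
  refine le_antisymm (Submodule.topologicalClosure_minimal _ (iSup_le hle) hB.isClosed) ?_
  rintro ⟨x, y⟩ hxy
  refine mem_of_circleProj_mem hδ.generator _ fun k => ?_
  refine le_iSup (fun k => twistedGraph 𝒜 π D J δ Γ ω k) k ?_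
  obtain ⟨z, hz⟩ := mem_span_generators (ω := ω) hD hJ hδ hΓ hstar
    (circleProj_mem hδ.generator k x) (mem_perturbedGraph.1 hxy k)
    (one_mem_mul_of_isHopfGalois 𝒜 hHG k)
  rw [rightMul_one, one_apply_eq_self] at hz
  have h1 := hle k hz
  have h2 := hB.circleProj_mem k hxy
  rw [← hB.toLinearPMap_graph] at h1 h2
  rwa [LinearPMap.mem_graph_snd_inj _ h1 h2 rfl] at hz

/-- `a` raises degree by `j` and commutes with `Z` and `· ω`, so the perturbations on `H_(k+j)` and
`H_k` differ only by the bounded term `-j (· ω)`. -/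
theorem isBoundedCommutator_twist (hD : IsSelfAdjoint D) (hJ : IsRealStructure π D J)
    (hδ : IsEquivariant 𝒜 π D J δ) (hω : IsStrongConnection 𝒜 π D δ ω)
    (hω_sa : IsSelfAdjoint ω) (hZA : ∀ a : A, Commute Z (π a)) {T : H →ₗ.[ℂ] H}
    (hT : T.graph = perturbedGraph δ D (twistPerturbation J Z ω)) {j : ℤ} {a : A}
    (ha : a ∈ 𝒜 j) {C : H →L[ℂ] H} (hC : IsBoundedCommutator D (π a) C) :
    IsBoundedCommutator T (π a) (C - (j : ℂ) • (rightForm J ω * π a)) := by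
  rintro ⟨x, y⟩ hxy
  rw [hT, mem_perturbedGraph] at hxy ⊢
  have hZπ : ∀ u : H, Z (π a u) = π a (Z u) := fun u =>
    congrArg (fun S : H →L[ℂ] H => S u) (hZA a).eq
  intro l
  obtain ⟨k, rfl⟩ : ∃ k, l = k + j := ⟨l - j, by omega⟩
  have h1 := hC _ (hxy k)
  simp only [map_add, sub_apply, smul_apply, mul_apply_eq_comp, map_sub, map_smul,
    hω.circleProj_rightForm hω_sa hJ hδ, hδ.circleProj_rep ha,
    hδ.circleProj_commutator hD ha hC]
  convert h1 using 2
  simp only [twistPerturbation, sub_apply, neg_apply, smul_apply, map_sub, map_neg, map_smul,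
    hZπ, hω.rightForm_rep hω_sa hJ]
  push_cast
  module

theorem exists_isBoundedCommutator_circleSum (hD : IsSpectralTriple π D)
    (hJ : IsRealStructure π D J) (hδ : IsEquivariant 𝒜 π D J δ) (hΓ : IsProjectable π D J δ Γ)
    (hω : IsStrongConnection 𝒜 π D δ ω)
    (hω_sa : IsSelfAdjoint ω) (hZA : ∀ a : A, Commute Z (π a)) {T : H →ₗ.[ℂ] H}
    (hT : T.graph = perturbedGraph δ D (twistPerturbation J Z ω)) (a : A) :
    ∃ C : H →L[ℂ] H, IsBoundedCommutator (circleSum δ T Γ) (π a) C := by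
  induction a using DirectSum.Decomposition.inductionOn 𝒜 with
  | zero => exact ⟨0, fun p _ => by simp⟩
  | add a b ha hb =>
    obtain ⟨C, hC⟩ := ha
    obtain ⟨C', hC'⟩ := hb
    exact ⟨C + C', by rw [map_add]; exact hC.add hC'⟩
  | @homogeneous j a =>
    obtain ⟨C, hC⟩ := hD.bounded_commutator (a : A)
    refine ⟨C - (j : ℂ) • (rightForm J ω * π a) + (j : ℂ) • (Γ * π a), ?_⟩
    rintro ⟨x, z⟩ hxz
    obtain ⟨w, y, hw, hy, rfl⟩ := mem_graph_circleSum.1 hxz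
    refine mem_graph_circleSum.2 ⟨_, _, hδ.isBoundedCommutator_rep a.2 (x, w) hw,
      isBoundedCommutator_twist hD.selfAdjoint hJ hδ hω hω_sa hZA hT a.2 hC (x, y) hy, ?_⟩
    have hΓπ : Γ (π a w) = π a (Γ w) := congrArg (fun S : H →L[ℂ] H => S w) (hΓ.comm_rep a).eq
    simp only [map_add, add_apply, sub_apply, smul_apply, map_smul, mul_apply_eq_comp, hΓπ]
    abel

theorem hasCompactResolvent_twist (hD : IsSpectralTriple π D) (hJ : IsRealStructure π D J)
    (hδ : IsEquivariant 𝒜 π D J δ) (hΓ : IsProjectable π D J δ Γ)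
    (hZ : IsFibreRemainder π D J δ Γ 1 Z) (hω : IsStrongConnection 𝒜 π D δ ω)
    (hω_sa : IsSelfAdjoint ω) (hZA : ∀ a : A, Commute Z (π a)) {T : H →ₗ.[ℂ] H}
    (hT : T.graph = perturbedGraph δ D (twistPerturbation J Z ω)) :
    HasCompactResolvent (circleSum δ T Γ) := by
  have hodd := isOddCircleOperator_twist hD.selfAdjoint hJ hδ hΓ hZ hω hω_sa hZA hT
  obtain ⟨z, K, hK, -, hK'⟩ := hD.compact_resolvent
  refine hodd.hasCompactResolvent_circleSum fun k =>
    -- On `H_k`, `D x - z x = y - B_k x - z x` with `B_k` the perturbation, so the resolvent `K` of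
    -- `D` recovers `x` from `y + E x` with `E = -B_k - z`.
    ⟨K, -(twistPerturbation J Z ω k) - z • 1, hK, fun x y hx hxy => ?_⟩
  have h1 := hodd.comm_op.circleProj_mem k hxy
  rw [circleProj_of_mem hx] at h1
  have h2 := T.mem_graph_snd_inj h1 hxy rfl
  rw [hT, mem_perturbedGraph] at hxy
  have h3 := hxy k
  rw [circleProj_of_mem hx, h2] at h3
  have h4 := hK' _ h3
  simp only at h4
  conv_lhs => rw [← h4]
  congr 1
  simp only [sub_apply, neg_apply, smul_apply, one_apply_eq_self]
  abel

end Twisted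

end CircleBundle

theorem mainTheorem6
    {A : Type*} [Ring A] [StarRing A] [Algebra ℂ A] [StarModule ℂ A]
    {H : Type*} [NormedAddCommGroup H] [InnerProductSpace ℂ H] [CompleteSpace H]
    -- the `U(1)` bundle `ℬ = 𝒜 0 ↪ A`
    (𝒜 : ℤ → Submodule ℂ A) [GradedAlgebra 𝒜]
    (hstar : ∀ (k : ℤ) (a : A), a ∈ 𝒜 k → star a ∈ 𝒜 (-k))
    (hHG : IsHopfGalois 𝒜)
    -- the projectable `U(1)` equivariant real spectral triple with fibres of equal length
    (π : A →⋆ₐ[ℂ] (H →L[ℂ] H)) (D : H →ₗ.[ℂ] H) (J : H ≃ₗᵢ⋆[ℂ] H) (δ : H →ₗ.[ℂ] H)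
    (Γ Z : H →L[ℂ] H)
    (hD : IsSpectralTriple π D) (hJ : IsRealStructure π D J)
    (hδ : IsEquivariant 𝒜 π D J δ) (hΓ : IsProjectable π D J δ Γ)
    (hcalc : IsProjectableCalculus 𝒜 π D Γ) (hZ : IsFibreRemainder π D J δ Γ 1 Z)
    -- the selfadjoint strong connection
    (hdR : IsCompatibleCalculus 𝒜 π D)
    (ω : H →L[ℂ] H) (hω : IsStrongConnection 𝒜 π D δ ω) (hω_sa : IsSelfAdjoint ω)
    -- `Z` commutes with `A`
    (hZA : ∀ a : A, Commute Z (π a)) :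
    -- `D_ω` is well defined
    (twistedDirac 𝒜 π D J δ Γ ω).graph = twistedDiracGraph 𝒜 π D J δ Γ ω ∧
    -- `(A, 𝒟_ω, H)` is a projectable spectral triple with fibres of equal length
    IsSpectralTriple π (fullTwistedDirac 𝒜 π D J δ Γ ω) ∧
    CommutesWithCircle δ (fullTwistedDirac 𝒜 π D J δ Γ ω) ∧
    IsProjectable π (fullTwistedDirac 𝒜 π D J δ Γ ω) J δ Γ ∧
    HasEqualLengthFibres π (fullTwistedDirac 𝒜 π D J δ Γ ω) J δ Γ 1 ∧
    -- the horizontal part of `𝒟_ω` coincides with `D_ω`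
    horizontal Γ (fullTwistedDirac 𝒜 π D J δ Γ ω) ≤ twistedDirac 𝒜 π D J δ Γ ω ∧
    (horizontal Γ (fullTwistedDirac 𝒜 π D J δ Γ ω)).domain =
      (fullTwistedDirac 𝒜 π D J δ Γ ω).domain ∧
    (horizontal Γ (fullTwistedDirac 𝒜 π D J δ Γ ω)).closure = twistedDirac 𝒜 π D J δ Γ ω ∧
    -- `𝒟_ω² = D_ω² + δ²`
    pcomp (fullTwistedDirac 𝒜 π D J δ Γ ω) (fullTwistedDirac 𝒜 π D J δ Γ ω) =
      pcomp (twistedDirac 𝒜 π D J δ Γ ω) (twistedDirac 𝒜 π D J δ Γ ω) + pcomp δ δ := by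
  have hG := twistedDiracGraph_eq hHG hD hJ hδ hΓ hstar hZ hω hω_sa
  have hB := isFibrePerturbation_twist hD.selfAdjoint hJ hδ hΓ hZ hω hω_sa
  have hT : (twistedDirac 𝒜 π D J δ Γ ω).graph =
      perturbedGraph δ D (twistPerturbation J Z ω) := by
    rw [twistedDirac, hG, hB.toLinearPMap_graph]
  have hodd := isOddCircleOperator_twist hD.selfAdjoint hJ hδ hΓ hZ hω hω_sa hZA hT
  have hfull : fullTwistedDirac 𝒜 π D J δ Γ ω = circleSum δ (twistedDirac 𝒜 π D J δ Γ ω) Γ := rfl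
  rw [hfull]
  -- The remainder of the new operator is `0`: its horizontal part is `D_ω` restricted to `dom δ`,
  -- and what is left is exactly `Γ δ`.
  refine ⟨hT.trans hG.symm, ⟨hodd.isSelfAdjoint_circleSum, ?_, ?_⟩,
    hodd.commutesWithCircle_circleSum, ?_, ⟨0, ?_, ?_, ?_⟩, hodd.horizontal_circleSum_le,
    hodd.domain_horizontal_circleSum, hodd.closure_horizontal_circleSum,
    hodd.pcomp_circleSum_self⟩
  · exact exists_isBoundedCommutator_circleSum hD hJ hδ hΓ hω hω_sa hZA hT
  · exact hasCompactResolvent_twist hD hJ hδ hΓ hZ hω hω_sa hZA hT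
  · exact ⟨hΓ.comm_rep, hΓ.anticomm_real, hΓ.comm_circle, hΓ.selfAdjoint, hΓ.sq,
      hodd.apply_mem_domain_circleSum⟩
  · rw [hodd.circleSum_sub_horizontal_sub_vertical_domain]
    exact hodd.isSelfAdjoint_circleSum.dense_domain
  · rintro ⟨x, y⟩ hxy
    exact (hodd.circleSum_sub_horizontal_sub_vertical_eq_zero hxy).symm
  · exact fun a => Commute.zero_left _
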